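/- Throughout, standard probability spaces are standard Borel spaces with a probability measure, and measure-preserving transformations that agree almost everywhere are identified. For a standard probability space $(X,\mu)$ let $\mathrm{Aut}(X,\mu)$ be the group of measure-preserving Borel automorphisms of $(X,\mu)$ with the weak topology, in which $T_n \to T$ if and only if $\mu(T_nD \,\triangle\, TD) \to 0$ for every measurable $D \subseteq X$. For a countable group $\Gamma$ let $\mathrm{Act}(\Gamma,X,\mu)$ be the set of homomorphisms $\Gamma \to \mathrm{Aut}(X,\mu)$, topologized as a subspace of $\mathrm{Aut}(X,\mu)^\Gamma$. For $A \in \mathrm{Act}(\Gamma,X,\mu)$ let $\mathcal{E}_A$ be the $\sigma$-algebra of those measurable $D$ with $\mu(A^gD \,\triangle\, D)=0$ for all $g\in\Gamma$. The action $A$ is ergodic if $\mathcal{E}_A$ consists exactly of the measurable sets of measure $0$ or $1$; $\mathrm{Erg}(\Gamma,X,\mu)$ is the set of ergodic actions. An action of $G \times G$, with restrictions $A$ and $B$ to the two factors, is synergodic if it is ergodic and $\mathcal{E}_A \cup \mathcal{E}_B$ generates the $\sigma$-algebra of all measurable subsets of $X$. An infinite countable group $G$ is richly synergodic if the synergodic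 actions are dense in $\mathrm{Erg}(G\times G,X,\mu)$ for every diffuse (i.e. atomless) standard probability space $(X,\mu)$. Let $C^*(G)$ be the full group $C^*$-algebra of $G$, the completion of $\mathbb{C}[G]$ in the norm $\sup_\rho\|\rho(\cdot)\|$ over all unitary representations $\rho$ of $G$. Identify $\phi = \sum_{g,h} \phi(g,h)\,(g,h) \in \mathbb{C}[G\times G]$ with the element $\sum_{g,h}\phi(g,h)\, g\otimes h$ of the algebraic tensor product $C^*(G)\odot C^*(G)$, and put \[ \|\phi\|_{\max} = \sup \|(\alpha\odot\beta)(\phi)\|_{\mathrm{op}}, \qquad \|\phi\|_{\min} = \sup \|(\alpha\otimes\beta)(\phi)\|_{\mathrm{op}}, \] where the first supremum is over all pairs of commuting $*$-representations $\alpha,\beta$ of $C^*(G)$ on a common Hilbert space $H$, with $(\alpha\odot\beta)(a\otimes b)=\alpha(a)\beta(b)$, and the second is over all pairs of $*$-representations $\alpha,\beta$ of $C^*(G)$ on Hilbert spaces $H,K$, with $(\alpha\otimes\beta)(a\otimes b)=\alpha(a)\otimes\beta(b)$ acting on the Hilbert space tensor product of $H$ and $K$. **Corollary.** If $G$ is a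 richly synergodic (infinite countable) group, then $\|\phi\|_{\max}=\|\phi\|_{\min}$ for all $\phi\in\mathbb{C}[G\times G]$. -/

import Mathlib

open MeasureTheory Filter Topology
open scoped TensorProduct ENNReal symmDiff

universe u v

/-! ## Measure preserving transformations and their weak topology -/

section ErgodicTheory

/-- Measurable bijections of `X` with measurable inverse which preserve `μ`. -/
def MPEquiv {X : Type u} [MeasurableSpace X] (μ : Measure X) : Type u :=
  {e : X ≃ᵐ X // MeasurePreserving e μ μ}

/-- Two measure preserving transformations are identified if they agree `μ`-almost everywhere. -/
def aeSetoid {X : Type u} [MeasurableSpace X] (μ : Measure X) : Setoid (MPEquiv μ) where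
  r e f := (e.1 : X → X) =ᵐ[μ] f.1
  iseqv := ⟨fun _ => EventuallyEq.rfl, fun h => h.symm, fun h k => h.trans k⟩

/-- The group `Aut(X, μ)` of measure preserving transformations modulo almost everywhere
equality. -/
def Aut {X : Type u} [MeasurableSpace X] (μ : Measure X) : Type u := Quotient (aeSetoid μ)

namespace Aut

variable {X : Type u} [MeasurableSpace X] {μ : Measure X}

/-- The class of a transformation in `Aut(X, μ)`. -/
def mk (e : X ≃ᵐ X) (he : MeasurePreserving e μ μ) : Aut μ := Quotient.mk (aeSetoid μ) ⟨e, he⟩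

/-- The product of `Aut(X, μ)` is composition, `(S * T) x = S (T x)`. -/
instance : Mul (Aut μ) where
  mul := Quotient.map₂ (fun S T => ⟨T.1.trans S.1, S.2.comp T.2⟩) <| by
    intro S S' hS T T' hT
    have h1 : (fun x => S.1 (T.1 x)) =ᵐ[μ] fun x => S'.1 (T.1 x) :=
      T.2.quasiMeasurePreserving.ae_eq_comp hS
    have h2 : (fun x => S'.1 (T.1 x)) =ᵐ[μ] fun x => S'.1 (T'.1 x) :=
      EventuallyEq.fun_comp hT S'.1
    exact h1.trans h2

instance : One (Aut μ) where
  one := mk (MeasurableEquiv.refl X) (MeasurePreserving.id μ)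

instance : Inv (Aut μ) where
  inv := Quotient.map (fun T => ⟨T.1.symm, T.2.symm T.1⟩) <| by
    intro S T h
    have h1 : (fun x => S.1 (S.1.symm x)) =ᵐ[μ] fun x => T.1 (S.1.symm x) :=
      (S.2.symm S.1).quasiMeasurePreserving.ae_eq_comp h
    change (S.1.symm : X → X) =ᵐ[μ] T.1.symm
    filter_upwards [h1] with x hx
    have hx' : x = T.1 (S.1.symm x) := by simpa using hx
    exact (T.1.symm_apply_eq.mpr hx').symm

instance : Group (Aut μ) where
  mul_assoc := by rintro ⟨a⟩ ⟨b⟩ ⟨c⟩; rfl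
  one_mul := by rintro ⟨a⟩; rfl
  mul_one := by rintro ⟨a⟩; rfl
  inv_mul_cancel := by
    rintro ⟨a⟩
    exact Quotient.sound (s := aeSetoid μ) (Eventually.of_forall fun x => a.1.symm_apply_apply x)

/-- `μ (S D ∆ T D)`, where `S D` is the image of `D` under `S`. -/
noncomputable def imageDist (D : Set X) : Aut μ → Aut μ → ℝ≥0∞ :=
  Quotient.lift₂ (fun S T => μ ((S.1 '' D) ∆ (T.1 '' D))) <| by
    intro S T S' T' hS hT
    have key : ∀ {P Q : MPEquiv μ}, (P.1 : X → X) =ᵐ[μ] Q.1 →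
        (P.1 '' D : Set X) =ᵐ[μ] (Q.1 '' D : Set X) := by
      intro P Q h
      have h1 : (fun x => P.1 (P.1.symm x)) =ᵐ[μ] fun x => Q.1 (P.1.symm x) :=
        (P.2.symm P.1).quasiMeasurePreserving.ae_eq_comp h
      have h2 : (P.1.symm : X → X) =ᵐ[μ] Q.1.symm := by
        filter_upwards [h1] with x hx
        have hx' : x = Q.1 (P.1.symm x) := by simpa using hx
        exact (Q.1.symm_apply_eq.mpr hx').symm
      rw [P.1.image_eq_preimage_symm, Q.1.image_eq_preimage_symm]
      filter_upwards [h2] with x hx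
      exact congrArg (· ∈ D) hx
    exact measure_congr ((key hS).symmDiff (key hT))

@[simp] theorem imageDist_mk (D : Set X) (e f : X ≃ᵐ X) (he : MeasurePreserving e μ μ)
    (hf : MeasurePreserving f μ μ) :
    imageDist D (mk e he) (mk f hf) = μ ((e '' D) ∆ (f '' D)) := rfl

/-- The weak topology: the coarsest topology for which all the functions `T ↦ μ (T D ∆ S D)` with
`D` measurable and `S ∈ Aut(X, μ)` are continuous. A sequence `T n` converges to `T` if and only if
`μ (T n D ∆ T D) → 0` for every measurable `D`. -/
noncomputable instance : TopologicalSpace (Aut μ) :=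
  ⨅ (D : {D : Set X // MeasurableSet D}) (S : Aut μ),
    TopologicalSpace.induced (fun T => imageDist D.1 T S) inferInstance

/-- `D` is `T`-invariant if `μ (T D ∆ D) = 0`. -/
def IsInvariant (T : Aut μ) (D : Set X) : Prop := imageDist D T 1 = 0

theorem isInvariant_mk {e : X ≃ᵐ X} (he : MeasurePreserving e μ μ) {D : Set X} :
    (mk e he).IsInvariant D ↔ (e '' D : Set X) =ᵐ[μ] D := by
  have : imageDist D (mk e he) 1 = μ ((e '' D) ∆ (id '' D)) := rfl
  rw [IsInvariant, this, Set.image_id, measure_symmDiff_eq_zero_iff]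

end Aut

/-! ## Actions, invariant σ-algebras, ergodicity, synergodicity -/

/-- `Act(Γ, X, μ)`: the probability measure preserving actions of `Γ` on `(X, μ)`. -/
def Act (Γ : Type v) [Group Γ] {X : Type u} [MeasurableSpace X] (μ : Measure X) :
    Type (max u v) :=
  Γ →* Aut μ

namespace Act

variable {Γ : Type v} [Group Γ] {X : Type u} [mX : MeasurableSpace X] {μ : Measure X}

/-- The topology that `Act(Γ, X, μ)` inherits from the product space `Aut(X, μ)^Γ`. -/
noncomputable instance : TopologicalSpace (Act Γ μ) :=
  TopologicalSpace.induced (fun (A : Γ →* Aut μ) (g : Γ) => A g) inferInstance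

/-- The σ-algebra of measurable sets that are invariant under every element of the action. -/
@[reducible] def invariants (A : Γ →* Aut μ) : MeasurableSpace X where
  MeasurableSet' D := MeasurableSet D ∧ ∀ g, (A g).IsInvariant D
  measurableSet_empty := by
    refine ⟨MeasurableSet.empty, fun g => ?_⟩
    obtain ⟨⟨e, he⟩, h⟩ := Quotient.exists_rep (A g)
    rw [← h]
    exact (Aut.isInvariant_mk he).mpr (by simp)
  measurableSet_compl D := by
    rintro ⟨hD, h⟩
    refine ⟨hD.compl, fun g => ?_⟩
    have hg := h g
    obtain ⟨⟨e, he⟩, h⟩ := Quotient.exists_rep (A g)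
    rw [← h] at hg ⊢
    refine (Aut.isInvariant_mk he).mpr ?_
    rw [Set.image_compl_eq e.bijective]
    exact ((Aut.isInvariant_mk he).mp hg).compl
  measurableSet_iUnion f hf := by
    refine ⟨MeasurableSet.iUnion fun i => (hf i).1, fun g => ?_⟩
    have hg := fun i => (hf i).2 g
    obtain ⟨⟨e, he⟩, h⟩ := Quotient.exists_rep (A g)
    rw [← h] at hg ⊢
    refine (Aut.isInvariant_mk he).mpr ?_
    rw [Set.image_iUnion]
    exact Filter.EventuallyEq.countable_iUnion fun i => (Aut.isInvariant_mk he).mp (hg i)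

/-- An action is ergodic if its invariant sets are exactly the measurable sets of measure `0`
or `1`. -/
def IsErgodic (A : Act Γ μ) : Prop :=
  ∀ D : Set X, MeasurableSet[invariants A] D ↔ MeasurableSet D ∧ (μ D = 0 ∨ μ D = 1)

/-- `Erg(Γ, X, μ)`, the set of ergodic actions. -/
def erg (Γ : Type v) [Group Γ] {X : Type u} [MeasurableSpace X] (μ : Measure X) :
    Set (Act Γ μ) :=
  {A | IsErgodic A}

/-- The restriction of an action of a product group to the first factor. -/
def fst {G H : Type v} [Group G] [Group H] (A : Act (G × H) μ) : Act G μ :=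
  MonoidHom.comp (M := G) (N := G × H) (P := Aut μ) A (MonoidHom.inl G H)

/-- The restriction of an action of a product group to the second factor. -/
def snd {G H : Type v} [Group G] [Group H] (A : Act (G × H) μ) : Act H μ :=
  MonoidHom.comp (M := H) (N := G × H) (P := Aut μ) A (MonoidHom.inr G H)

/-- An action of a product group is synergodic if it is ergodic and the invariant sets of the two
factor groups together generate the σ-algebra of all measurable sets. -/
def IsSynergodic {G H : Type v} [Group G] [Group H] (A : Act (G × H) μ) : Prop :=
  A.IsErgodic ∧ invariants A.fst ⊔ invariants A.snd = mX

end Act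

/-- `G` is richly synergodic if the synergodic actions are dense in `Erg(G × G, X, μ)`, for every
diffuse standard probability space `(X, μ)`. Every standard Borel space is isomorphic to one whose
underlying type lies in `Type`. -/
def RichlySynergodic (G : Type v) [Group G] : Prop :=
  ∀ (X : Type) [MeasurableSpace X] [StandardBorelSpace X] (μ : Measure X)
    [IsProbabilityMeasure μ] [NullSingletonClass μ],
    Dense {A : Act.erg (G × G) μ | (A : Act (G × G) μ).IsSynergodic}

end ErgodicTheory

/-! ## The full group C*-algebra -/

section GroupCStar

variable {G : Type u} [Group G]

/-- The linear extension to the group ring of a unitary representation. -/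
noncomputable def groupRingRep {H : Type v} [NormedAddCommGroup H] [InnerProductSpace ℂ H]
    [CompleteSpace H] (ρ : G →* unitary (H →L[ℂ] H)) : MonoidAlgebra ℂ G →ₐ[ℂ] (H →L[ℂ] H) :=
  MonoidAlgebra.lift ℂ (H →L[ℂ] H) G ((unitary (H →L[ℂ] H)).subtype.comp ρ)

/-- The set of the numbers `‖ρ(φ)‖`, where `ρ` ranges over all unitary representations of `G`. -/
def repNorms (φ : MonoidAlgebra ℂ G) : Set ℝ :=
  {r | ∃ (H : Type u) (_ : NormedAddCommGroup H) (_ : InnerProductSpace ℂ H) (_ : CompleteSpace H)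
    (ρ : G →* unitary (H →L[ℂ] H)), r = ‖groupRingRep ρ φ‖}

/-- The universal C*-norm on the group ring, the supremum of `‖ρ(φ)‖` over all unitary
representations `ρ` of `G`. -/
noncomputable def fullNorm (φ : MonoidAlgebra ℂ G) : ℝ := sSup (repNorms φ)

theorem norm_groupRingRep_le {H : Type v} [NormedAddCommGroup H] [InnerProductSpace ℂ H]
    [CompleteSpace H] (ρ : G →* unitary (H →L[ℂ] H)) (φ : MonoidAlgebra ℂ G) :
    ‖groupRingRep ρ φ‖ ≤ ∑ g ∈ φ.coeff.support, ‖φ.coeff g‖ := by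
  rw [groupRingRep, MonoidAlgebra.lift_apply]
  refine (norm_sum_le _ _).trans (Finset.sum_le_sum fun g _ => ?_)
  rw [norm_smul]
  refine mul_le_of_le_one_right (norm_nonneg _) ?_
  rcases subsingleton_or_nontrivial (H →L[ℂ] H) with h | h
  · simp [Subsingleton.elim (_ : H →L[ℂ] H) 0]
  · exact (CStarRing.norm_of_mem_unitary (ρ g).2).le

theorem bddAbove_repNorms (φ : MonoidAlgebra ℂ G) : BddAbove (repNorms φ) := by
  refine ⟨∑ g ∈ φ.coeff.support, ‖φ.coeff g‖, ?_⟩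
  rintro r ⟨H, _, _, _, ρ, rfl⟩
  exact norm_groupRingRep_le ρ φ

theorem repNorms_nonempty (φ : MonoidAlgebra ℂ G) : (repNorms φ).Nonempty :=
  ⟨_, EuclideanSpace ℂ PEmpty.{u + 1}, inferInstance, inferInstance, inferInstance, 1, rfl⟩

theorem le_fullNorm {H : Type u} [NormedAddCommGroup H] [InnerProductSpace ℂ H]
    [CompleteSpace H] (ρ : G →* unitary (H →L[ℂ] H)) (φ : MonoidAlgebra ℂ G) :
    ‖groupRingRep ρ φ‖ ≤ fullNorm φ :=
  le_csSup (bddAbove_repNorms φ) ⟨H, _, _, _, ρ, rfl⟩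

theorem fullNorm_le {φ : MonoidAlgebra ℂ G} {C : ℝ}
    (h : ∀ (H : Type u) [NormedAddCommGroup H] [InnerProductSpace ℂ H] [CompleteSpace H]
      (ρ : G →* unitary (H →L[ℂ] H)), ‖groupRingRep ρ φ‖ ≤ C) : fullNorm φ ≤ C := by
  refine csSup_le (repNorms_nonempty φ) ?_
  rintro r ⟨H, _, _, _, ρ, rfl⟩
  exact h H ρ

theorem fullNorm_nonneg (φ : MonoidAlgebra ℂ G) : 0 ≤ fullNorm φ :=
  (norm_nonneg _).trans (le_fullNorm (H := EuclideanSpace ℂ PEmpty.{u + 1}) 1 φ)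

/-- The group ring `ℂ[G]`, to be equipped with its involution and its universal C*-norm. -/
def GroupRing (G : Type u) [Group G] : Type u := MonoidAlgebra ℂ G

namespace GroupRing

noncomputable instance : Ring (GroupRing G) := inferInstanceAs (Ring (MonoidAlgebra ℂ G))

noncomputable instance : Algebra ℂ (GroupRing G) :=
  inferInstanceAs (Algebra ℂ (MonoidAlgebra ℂ G))

/-- The group element `g` as an element of `ℂ[G]`. -/
noncomputable def of (g : G) : GroupRing G := MonoidAlgebra.of ℂ G g

theorem of_mul (g h : G) : (of (g * h) : GroupRing G) = of g * of h :=
  map_mul (MonoidAlgebra.of ℂ G) g h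

/-- The extension of a unitary representation of `G` to `ℂ[G]`. -/
noncomputable def rep {H : Type v} [NormedAddCommGroup H] [InnerProductSpace ℂ H]
    [CompleteSpace H] (ρ : G →* unitary (H →L[ℂ] H)) : GroupRing G →ₐ[ℂ] (H →L[ℂ] H) :=
  groupRingRep ρ

theorem rep_of {H : Type v} [NormedAddCommGroup H] [InnerProductSpace ℂ H]
    [CompleteSpace H] (ρ : G →* unitary (H →L[ℂ] H)) (g : G) :
    rep ρ (of g) = (ρ g : H →L[ℂ] H) := by
  change groupRingRep ρ (MonoidAlgebra.of ℂ G g) = _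
  simp [groupRingRep]

theorem induction_on {p : GroupRing G → Prop} (x : GroupRing G) (of : ∀ g, p (of g))
    (add : ∀ x y, p x → p y → p (x + y)) (smul : ∀ (c : ℂ) (x), p x → p (c • x)) : p x :=
  MonoidAlgebra.induction_on (motive := p) x of add smul

/-- The involution `φ* (g) = conj (φ (g⁻¹))`. -/
noncomputable instance : Star (GroupRing G) where
  star φ := MonoidAlgebra.ofCoeff <| Finsupp.equivMapDomain (Equiv.inv G) <|
    Finsupp.mapRange star (star_zero ℂ) (MonoidAlgebra.coeff φ)

theorem coeff_star (φ : GroupRing G) (g : G) :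
    (MonoidAlgebra.coeff (star φ : GroupRing G) : G →₀ ℂ) g =
      star ((MonoidAlgebra.coeff φ : G →₀ ℂ) g⁻¹) := rfl

theorem ext_coeff {φ ψ : GroupRing G} (h : ∀ g, (MonoidAlgebra.coeff φ : G →₀ ℂ) g =
    (MonoidAlgebra.coeff ψ : G →₀ ℂ) g) : φ = ψ :=
  MonoidAlgebra.ext (Finsupp.ext h)

theorem star_add' (φ ψ : GroupRing G) : star (φ + ψ) = star φ + star ψ :=
  ext_coeff fun g => star_add (φ.coeff g⁻¹) (ψ.coeff g⁻¹)

theorem star_smul' (c : ℂ) (φ : GroupRing G) : star (c • φ) = star c • star φ :=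
  ext_coeff fun g => by
    change star (c * φ.coeff g⁻¹) = star c * star (φ.coeff g⁻¹)
    simp

theorem star_of (g : G) : star (of g) = (of g⁻¹ : GroupRing G) :=
  ext_coeff fun h => by
    classical
    rw [coeff_star]
    change star ((MonoidAlgebra.of ℂ G g).coeff h⁻¹) = (MonoidAlgebra.of ℂ G g⁻¹).coeff h
    by_cases hg : g = h⁻¹
    · simp [hg]
    · have hg' : g⁻¹ ≠ h := fun e => hg (by rw [← e, inv_inv])
      simp [hg, hg']

theorem star_mul' (φ ψ : GroupRing G) : star (φ * ψ) = star ψ * star φ := by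
  induction φ using induction_on with
  | of g =>
    induction ψ using induction_on with
    | of h => rw [← of_mul, star_of, star_of, star_of, ← of_mul, mul_inv_rev]
    | add x y hx hy => rw [mul_add, star_add', hx, hy, star_add', add_mul]
    | smul c x hx => rw [mul_smul_comm, star_smul', hx, star_smul', smul_mul_assoc]
  | add x y hx hy => rw [add_mul, star_add', hx, hy, star_add', mul_add]
  | smul c x hx => rw [smul_mul_assoc, star_smul', hx, star_smul', mul_smul_comm]

noncomputable instance : StarRing (GroupRing G) where
  star_involutive φ := ext_coeff fun g => by simp [coeff_star]
  star_mul := star_mul'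
  star_add := star_add'

instance : StarModule ℂ (GroupRing G) := ⟨star_smul'⟩

theorem rep_star {H : Type v} [NormedAddCommGroup H] [InnerProductSpace ℂ H]
    [CompleteSpace H] (ρ : G →* unitary (H →L[ℂ] H)) (φ : GroupRing G) :
    rep ρ (star φ) = star (rep ρ φ) := by
  induction φ using induction_on with
  | of g => rw [star_of, rep_of, rep_of, map_inv, ← Unitary.star_eq_inv]; rfl
  | add x y hx hy => rw [star_add, map_add, map_add, hx, hy, star_add]
  | smul c x hx => rw [star_smul, map_smul, map_smul, hx, star_smul]

theorem le_fullNorm' {H : Type u} [NormedAddCommGroup H] [InnerProductSpace ℂ H]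
    [CompleteSpace H] (ρ : G →* unitary (H →L[ℂ] H)) (φ : GroupRing G) :
    ‖rep ρ φ‖ ≤ fullNorm φ := le_fullNorm ρ φ

theorem fullNorm_le' {φ : GroupRing G} {C : ℝ}
    (h : ∀ (H : Type u) [NormedAddCommGroup H] [InnerProductSpace ℂ H] [CompleteSpace H]
      (ρ : G →* unitary (H →L[ℂ] H)), ‖rep ρ φ‖ ≤ C) : fullNorm φ ≤ C := fullNorm_le h

/-- The universal C*-norm as a ring seminorm on `ℂ[G]`. -/
noncomputable def ringSeminorm (G : Type u) [Group G] : RingSeminorm (GroupRing G) where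
  toFun φ := fullNorm φ
  map_zero' := le_antisymm (fullNorm_le' fun H _ _ _ ρ => by simp) (fullNorm_nonneg _)
  add_le' φ ψ := fullNorm_le' fun H _ _ _ ρ => by
    rw [map_add]
    exact (norm_add_le _ _).trans (add_le_add (le_fullNorm' ρ φ) (le_fullNorm' ρ ψ))
  neg' φ := le_antisymm
    (fullNorm_le' fun H _ _ _ ρ => by rw [map_neg, norm_neg]; exact le_fullNorm' ρ φ)
    (fullNorm_le' fun H _ _ _ ρ => by
      rw [← norm_neg, ← map_neg]; exact le_fullNorm' ρ (-φ))
  mul_le' φ ψ := fullNorm_le' fun H _ _ _ ρ => by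
    rw [map_mul]
    exact (norm_mul_le _ _).trans
      (mul_le_mul (le_fullNorm' ρ φ) (le_fullNorm' ρ ψ) (norm_nonneg _) (fullNorm_nonneg _))

noncomputable instance : SeminormedAddCommGroup (GroupRing G) :=
  (ringSeminorm G).toAddGroupSeminorm.toSeminormedAddCommGroup

noncomputable instance : SeminormedRing (GroupRing G) where
  __ := (inferInstance : SeminormedAddCommGroup (GroupRing G))
  __ := (inferInstance : Ring (GroupRing G))
  norm_mul_le := (ringSeminorm G).mul_le'

theorem norm_def (φ : GroupRing G) : ‖φ‖ = fullNorm φ := rfl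

noncomputable instance : NormedAlgebra ℂ (GroupRing G) where
  __ := (inferInstance : Algebra ℂ (GroupRing G))
  norm_smul_le c φ := fullNorm_le' fun H _ _ _ ρ => by
    rw [map_smul, norm_smul]
    exact mul_le_mul_of_nonneg_left (le_fullNorm' ρ φ) (norm_nonneg _)

theorem norm_star' (φ : GroupRing G) : ‖star φ‖ = ‖φ‖ := by
  have key : ∀ φ : GroupRing G, ‖star φ‖ ≤ ‖φ‖ := fun φ => fullNorm_le' fun H _ _ _ ρ => by
    rw [rep_star, norm_star]
    exact le_fullNorm' ρ φ
  exact le_antisymm (key φ) (by simpa using key (star φ))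

theorem norm_mul_self_le (φ : GroupRing G) : ‖φ‖ * ‖φ‖ ≤ ‖star φ * φ‖ := by
  have h : ‖φ‖ ≤ Real.sqrt ‖star φ * φ‖ := fullNorm_le' fun H _ _ _ ρ => by
    refine Real.le_sqrt_of_sq_le ?_
    rw [sq, ← CStarRing.norm_star_mul_self, ← rep_star, ← map_mul]
    exact le_fullNorm' ρ _
  calc ‖φ‖ * ‖φ‖ ≤ Real.sqrt ‖star φ * φ‖ * Real.sqrt ‖star φ * φ‖ :=
        mul_self_le_mul_self (norm_nonneg _) h
    _ = _ := Real.mul_self_sqrt (norm_nonneg _)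

theorem uniformContinuous_star : UniformContinuous (star : GroupRing G → GroupRing G) :=
  (AddMonoidHomClass.isometry_of_norm (starAddEquiv : GroupRing G ≃+ GroupRing G)
    norm_star').uniformContinuous

end GroupRing

/-- The full group C*-algebra `C*(G)`: the completion of `ℂ[G]` for its universal C*-norm. -/
def FullGroupCStar (G : Type u) [Group G] : Type u := UniformSpace.Completion (GroupRing G)

namespace FullGroupCStar

open UniformSpace

noncomputable instance : NormedRing (FullGroupCStar G) :=
  inferInstanceAs (NormedRing (Completion (GroupRing G)))

noncomputable instance : Algebra ℂ (FullGroupCStar G) :=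
  inferInstanceAs (Algebra ℂ (Completion (GroupRing G)))

noncomputable instance : NormedAlgebra ℂ (FullGroupCStar G) where
  norm_smul_le := (inferInstance : NormedSpace ℂ (Completion (GroupRing G))).norm_smul_le

instance : CompleteSpace (FullGroupCStar G) :=
  inferInstanceAs (CompleteSpace (Completion (GroupRing G)))

/-- The canonical map from `ℂ[G]` to `C*(G)`. -/
noncomputable def coe (φ : GroupRing G) : FullGroupCStar G := (φ : Completion (GroupRing G))

/-- The involution of `C*(G)`, the continuous extension of the involution of `ℂ[G]`. -/
noncomputable instance : Star (FullGroupCStar G) where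
  star := Completion.map (star : GroupRing G → GroupRing G)

theorem star_coe (φ : GroupRing G) : star (coe φ) = coe (star φ) :=
  Completion.map_coe GroupRing.uniformContinuous_star φ

theorem continuous_star' : Continuous (star : FullGroupCStar G → FullGroupCStar G) :=
  Completion.continuous_map

theorem induction_on {p : FullGroupCStar G → Prop} (x : FullGroupCStar G)
    (hp : IsClosed {x | p x}) (ih : ∀ φ, p (coe φ)) : p x :=
  Completion.induction_on (α := GroupRing G) x hp ih

theorem induction_on₂ {p : FullGroupCStar G → FullGroupCStar G → Prop} (x y : FullGroupCStar G)
    (hp : IsClosed {z : FullGroupCStar G × FullGroupCStar G | p z.1 z.2})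
    (ih : ∀ φ ψ, p (coe φ) (coe ψ)) : p x y :=
  Completion.induction_on₂ (α := GroupRing G) (β := GroupRing G) x y hp ih

theorem coe_mul (φ ψ : GroupRing G) : coe (φ * ψ) = coe φ * coe ψ := Completion.coe_mul φ ψ

theorem coe_add (φ ψ : GroupRing G) : coe (φ + ψ) = coe φ + coe ψ := Completion.coe_add φ ψ

theorem coe_smul (c : ℂ) (φ : GroupRing G) : coe (c • φ) = c • coe φ := Completion.coe_smul c φ

theorem norm_coe (φ : GroupRing G) : ‖coe φ‖ = fullNorm φ := Completion.norm_coe φ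

noncomputable instance : StarRing (FullGroupCStar G) where
  star_involutive x := by
    refine induction_on (p := fun x => star (star x) = x) x
      (isClosed_eq (continuous_star'.comp continuous_star') continuous_id) fun φ => ?_
    rw [star_coe, star_coe, star_star]
  star_mul x y := by
    refine induction_on₂ (p := fun x y => star (x * y) = star y * star x) x y
      (isClosed_eq (continuous_star'.comp continuous_mul)
        ((continuous_star'.comp continuous_snd).mul (continuous_star'.comp continuous_fst)))
      fun φ ψ => ?_
    rw [← coe_mul, star_coe, star_coe, star_coe, star_mul, coe_mul]
  star_add x y := by
    refine induction_on₂ (p := fun x y => star (x + y) = star x + star y) x y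
      (isClosed_eq (continuous_star'.comp continuous_add)
        ((continuous_star'.comp continuous_fst).add (continuous_star'.comp continuous_snd)))
      fun φ ψ => ?_
    rw [← coe_add, star_coe, star_coe, star_coe, star_add, coe_add]

instance : StarModule ℂ (FullGroupCStar G) where
  star_smul c x := by
    refine induction_on (p := fun x => star (c • x) = star c • star x) x
      (isClosed_eq (continuous_star'.comp (continuous_const_smul c))
        (continuous_star'.const_smul (star c))) fun φ => ?_
    rw [← coe_smul, star_coe, star_coe, star_smul, coe_smul]

instance : CStarRing (FullGroupCStar G) where
  norm_mul_self_le x := by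
    refine induction_on (p := fun x => ‖x‖ * ‖x‖ ≤ ‖star x * x‖) x
      (isClosed_le (continuous_norm.mul continuous_norm)
        (continuous_star'.mul continuous_id).norm) fun φ => ?_
    rw [star_coe, ← coe_mul, norm_coe, norm_coe]
    exact GroupRing.norm_mul_self_le φ

noncomputable instance : CStarAlgebra (FullGroupCStar G) where

/-- The canonical unitary of `C*(G)` given by `g ∈ G`. -/
noncomputable def of (g : G) : FullGroupCStar G := coe (GroupRing.of g)

end FullGroupCStar

end GroupCStar

/-! ## The maximal and the minimal C*-norm on algebraic tensor products -/

section TensorNorms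

open UniformSpace

/-- For linear maps `α : A → C` and `β : B → C` into an algebra, the linear map
`α ⊙ β : A ⊙ B → C` with `a ⊗ b ↦ α(a) β(b)`. -/
noncomputable def algTensor {A B C : Type*} [NonUnitalCStarAlgebra A] [NonUnitalCStarAlgebra B]
    [CStarAlgebra C] (α : A →⋆ₙₐ[ℂ] C) (β : B →⋆ₙₐ[ℂ] C) : A ⊗[ℂ] B →ₗ[ℂ] C :=
  TensorProduct.lift ((LinearMap.mul ℂ C).compl₁₂ (α : A →ₗ[ℂ] C) (β : B →ₗ[ℂ] C))

/-- The Hilbert space tensor product of `H` and `K`, the completion of the algebraic tensor product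
for the inner product with `⟪x ⊗ y, x' ⊗ y'⟫ = ⟪x, x'⟫ ⟪y, y'⟫`. -/
def HilbertTensor (H K : Type u) [NormedAddCommGroup H] [InnerProductSpace ℂ H]
    [NormedAddCommGroup K] [InnerProductSpace ℂ K] : Type u :=
  Completion (H ⊗[ℂ] K)

section Spatial

variable {H K : Type u} [NormedAddCommGroup H] [InnerProductSpace ℂ H]
    [NormedAddCommGroup K] [InnerProductSpace ℂ K]

noncomputable instance : NormedAddCommGroup (HilbertTensor H K) :=
  inferInstanceAs (NormedAddCommGroup (Completion (H ⊗[ℂ] K)))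

noncomputable instance : InnerProductSpace ℂ (HilbertTensor H K) :=
  inferInstanceAs (InnerProductSpace ℂ (Completion (H ⊗[ℂ] K)))

instance : CompleteSpace (HilbertTensor H K) :=
  inferInstanceAs (CompleteSpace (Completion (H ⊗[ℂ] K)))

/-- The embedding of the algebraic tensor product. -/
noncomputable def HilbertTensor.incl : H ⊗[ℂ] K →ₗᵢ[ℂ] HilbertTensor H K where
  toFun x := (x : Completion (H ⊗[ℂ] K))
  map_add' := Completion.coe_add
  map_smul' := Completion.coe_smul
  norm_map' := Completion.norm_coe

theorem HilbertTensor.induction_on {p : HilbertTensor H K → Prop} (x : HilbertTensor H K)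
    (hp : IsClosed {x | p x}) (ih : ∀ y : H ⊗[ℂ] K, p (incl y)) : p x :=
  Completion.induction_on (α := H ⊗[ℂ] K) x hp ih

/-- The operator `S ⊗ T` on the Hilbert space tensor product. -/
noncomputable def opTensor (S : H →L[ℂ] H) (T : K →L[ℂ] K) :
    HilbertTensor H K →L[ℂ] HilbertTensor H K where
  toFun := (TensorProduct.mapL S T).completion
  map_add' := (TensorProduct.mapL S T).completion.map_add
  map_smul' := (TensorProduct.mapL S T).completion.map_smul
  cont := (TensorProduct.mapL S T).completion.continuous

theorem opTensor_incl (S : H →L[ℂ] H) (T : K →L[ℂ] K) (x : H ⊗[ℂ] K) :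
    opTensor S T (HilbertTensor.incl x) = HilbertTensor.incl (TensorProduct.mapL S T x) :=
  ContinuousLinearMap.completion_apply_coe _ _

theorem hilbertTensor_ext {P Q : HilbertTensor H K →L[ℂ] HilbertTensor H K}
    (h : ∀ x : H ⊗[ℂ] K, P (HilbertTensor.incl x) = Q (HilbertTensor.incl x)) : P = Q := by
  ext x
  exact HilbertTensor.induction_on (p := fun x => P x = Q x) x
    (isClosed_eq P.continuous Q.continuous) h

theorem norm_opTensor_le (S : H →L[ℂ] H) (T : K →L[ℂ] K) : ‖opTensor S T‖ ≤ ‖S‖ * ‖T‖ := by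
  refine ContinuousLinearMap.opNorm_le_bound _ (by positivity) fun x => ?_
  refine HilbertTensor.induction_on (p := fun x => ‖opTensor S T x‖ ≤ ‖S‖ * ‖T‖ * ‖x‖) x
    (isClosed_le (by fun_prop) (by fun_prop)) fun y => ?_
  rw [opTensor_incl, LinearIsometry.norm_map, LinearIsometry.norm_map]
  exact (ContinuousLinearMap.le_opNorm _ _).trans
    (mul_le_mul_of_nonneg_right (TensorProduct.norm_mapL_le S T) (norm_nonneg _))

/-- `(S, T) ↦ S ⊗ T` as a bilinear map. -/
noncomputable def opTensorₗ : (H →L[ℂ] H) →ₗ[ℂ] (K →L[ℂ] K) →ₗ[ℂ]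
    (HilbertTensor H K →L[ℂ] HilbertTensor H K) :=
  LinearMap.mk₂ ℂ opTensor
    (fun S S' T => hilbertTensor_ext fun x => by
      simp only [add_apply, opTensor_incl, TensorProduct.mapL_add_left,
        map_add])
    (fun c S T => hilbertTensor_ext fun x => by
      simp only [smul_apply, opTensor_incl, TensorProduct.mapL_smul_left,
        map_smul])
    (fun S T T' => hilbertTensor_ext fun x => by
      simp only [add_apply, opTensor_incl, TensorProduct.mapL_add_right,
        map_add])
    (fun c S T => hilbertTensor_ext fun x => by
      simp only [smul_apply, opTensor_incl, TensorProduct.mapL_smul_right,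
        map_smul])

/-- For `*`-representations `α` of `A` on `H` and `β` of `B` on `K`, the linear map
`α ⊗ β : A ⊙ B → End(H ⊗ K)` with `a ⊗ b ↦ α(a) ⊗ β(b)`. -/
noncomputable def spatialTensor [CompleteSpace H] [CompleteSpace K] {A B : Type u}
    [NonUnitalCStarAlgebra A] [NonUnitalCStarAlgebra B]
    (α : A →⋆ₙₐ[ℂ] (H →L[ℂ] H)) (β : B →⋆ₙₐ[ℂ] (K →L[ℂ] K)) :
    A ⊗[ℂ] B →ₗ[ℂ] (HilbertTensor H K →L[ℂ] HilbertTensor H K) :=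
  TensorProduct.lift
    (opTensorₗ.compl₁₂ (α : A →ₗ[ℂ] (H →L[ℂ] H)) (β : B →ₗ[ℂ] (K →L[ℂ] K)))

end Spatial

variable {A B : Type u} [NonUnitalCStarAlgebra A] [NonUnitalCStarAlgebra B]

/-- The set of the numbers `‖(α ⊙ β)(t)‖`, where `α` and `β` range over all pairs of commuting
`*`-representations of `A` and `B` on the same Hilbert space. -/
def maxTensorNorms (t : A ⊗[ℂ] B) : Set ℝ :=
  {r | ∃ (H : Type u) (_ : NormedAddCommGroup H) (_ : InnerProductSpace ℂ H) (_ : CompleteSpace H)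
    (α : A →⋆ₙₐ[ℂ] (H →L[ℂ] H)) (β : B →⋆ₙₐ[ℂ] (H →L[ℂ] H)),
    (∀ a b, Commute (α a) (β b)) ∧ r = ‖algTensor α β t‖}

/-- The norm of the maximal C*-tensor product of `A` and `B` on the algebraic tensor product. -/
noncomputable def maxTensorNorm (t : A ⊗[ℂ] B) : ℝ := sSup (maxTensorNorms t)

/-- The set of the numbers `‖(α ⊗ β)(t)‖`, where `α` and `β` range over all `*`-representations
of `A` and of `B`. -/
def minTensorNorms (t : A ⊗[ℂ] B) : Set ℝ :=
  {r | ∃ (H : Type u) (_ : NormedAddCommGroup H) (_ : InnerProductSpace ℂ H) (_ : CompleteSpace H)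
    (K : Type u) (_ : NormedAddCommGroup K) (_ : InnerProductSpace ℂ K) (_ : CompleteSpace K)
    (α : A →⋆ₙₐ[ℂ] (H →L[ℂ] H)) (β : B →⋆ₙₐ[ℂ] (K →L[ℂ] K)), r = ‖spatialTensor α β t‖}

/-- The norm of the minimal C*-tensor product of `A` and `B` on the algebraic tensor product. -/
noncomputable def minTensorNorm (t : A ⊗[ℂ] B) : ℝ := sSup (minTensorNorms t)

/-- The supremum that defines the maximal norm is a supremum of a nonempty bounded set. -/
theorem maxTensorNorms_nonempty_bddAbove (t : A ⊗[ℂ] B) :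
    (maxTensorNorms t).Nonempty ∧ BddAbove (maxTensorNorms t) := by
  refine ⟨⟨_, EuclideanSpace ℂ PEmpty.{u + 1}, inferInstance, inferInstance, inferInstance, 0, 0,
    fun a b => Commute.zero_left _, rfl⟩, ?_⟩
  induction t using TensorProduct.induction_on with
  | zero =>
    refine ⟨0, ?_⟩
    rintro r ⟨H, _, _, _, α, β, -, rfl⟩
    simp
  | tmul a b =>
    refine ⟨‖a‖ * ‖b‖, ?_⟩
    rintro r ⟨H, _, _, _, α, β, -, rfl⟩
    exact (norm_mul_le (α a) (β b)).trans (mul_le_mul (NonUnitalStarAlgHom.norm_apply_le α a)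
      (NonUnitalStarAlgHom.norm_apply_le β b) (norm_nonneg _) (norm_nonneg _))
  | add x y hx hy =>
    obtain ⟨C, hC⟩ := hx
    obtain ⟨D, hD⟩ := hy
    refine ⟨C + D, ?_⟩
    rintro r ⟨H, _, _, _, α, β, h, rfl⟩
    rw [map_add]
    exact (norm_add_le _ _).trans
      (add_le_add (hC ⟨H, _, _, _, α, β, h, rfl⟩) (hD ⟨H, _, _, _, α, β, h, rfl⟩))

/-- The supremum that defines the minimal norm is a supremum of a nonempty bounded set. -/
theorem minTensorNorms_nonempty_bddAbove (t : A ⊗[ℂ] B) :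
    (minTensorNorms t).Nonempty ∧ BddAbove (minTensorNorms t) := by
  refine ⟨⟨_, EuclideanSpace ℂ PEmpty.{u + 1}, inferInstance, inferInstance, inferInstance,
    EuclideanSpace ℂ PEmpty.{u + 1}, inferInstance, inferInstance, inferInstance, 0, 0, rfl⟩, ?_⟩
  induction t using TensorProduct.induction_on with
  | zero =>
    refine ⟨0, ?_⟩
    rintro r ⟨H, _, _, _, K, _, _, _, α, β, rfl⟩
    simp
  | tmul a b =>
    refine ⟨‖a‖ * ‖b‖, ?_⟩
    rintro r ⟨H, _, _, _, K, _, _, _, α, β, rfl⟩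
    exact (norm_opTensor_le (α a) (β b)).trans (mul_le_mul (NonUnitalStarAlgHom.norm_apply_le α a)
      (NonUnitalStarAlgHom.norm_apply_le β b) (norm_nonneg _) (norm_nonneg _))
  | add x y hx hy =>
    obtain ⟨C, hC⟩ := hx
    obtain ⟨D, hD⟩ := hy
    refine ⟨C + D, ?_⟩
    rintro r ⟨H, _, _, _, K, _, _, _, α, β, rfl⟩
    rw [map_add]
    exact (norm_add_le _ _).trans (add_le_add (hC ⟨H, _, _, _, K, _, _, _, α, β, rfl⟩)
      (hD ⟨H, _, _, _, K, _, _, _, α, β, rfl⟩))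

/-- The identification of elements of `ℂ[G × G]` with elements of `C*(G) ⊙ C*(G)`: the linear map
that sends the group element `(g, h)` to `g ⊗ h`. -/
noncomputable def toTensor (G : Type u) [Group G] :
    MonoidAlgebra ℂ (G × G) →ₗ[ℂ] FullGroupCStar G ⊗[ℂ] FullGroupCStar G :=
  Finsupp.linearCombination ℂ
      (fun p : G × G => FullGroupCStar.of p.1 ⊗ₜ[ℂ] FullGroupCStar.of p.2) ∘ₗ
    (MonoidAlgebra.coeffLinearEquiv ℂ).toLinearMap

end TensorNorms

/-!
The maximal norm of `φ ∈ ℂ[G × G]` is the supremum of `‖π(φ)‖` over the unitary representations `π`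
of `G × G`, and it always dominates the minimal norm, so the point is to bound `‖π(φ)‖` by the
minimal norm for every `π`.

For the Koopman representation of a synergodic action this holds because the two σ-algebras of
invariant sets are independent, by ergodicity (`measureReal_inter_of_isErgodic`). As they generate,
`L²(X, μ)` is the tensor product of the two spaces of invariant functions, on each of which only
one of the two factors of `G × G` acts. So the representation is contained in the tensor product of
two representations of `G` (`norm_koopman_le_of_isSynergodic`). The Koopman representation depends
strongly continuously on the action, hence the density of the synergodic actions gives the same
bound for all ergodic actions on diffuse spaces (`norm_koopman_le_of_isErgodic`).

For a fixed continuous function `f` on a compact `G × G`-space, the inequality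
`‖κ(φ) f‖² ≤ C² ‖f‖²` in `L²(μ)` is linear in the invariant measure `μ`. By the Krein–Milman theorem
it passes from ergodic measures to arbitrary invariant measures (`norm_koopman_le_of_factor`). To
stay among diffuse measures, only the measures with a fixed image `l` in a factor are considered.
Extreme points of this set are ergodic if `l` itself is ergodic, and they are diffuse if `l` is;
a Bernoulli shift serves as such a factor (`isExtremalInvariant_infinitePi`).

Finally, every orbit `g ↦ π(g) ξ` is, up to a scalar, the covariance of an invariant complex
Gaussian process (`exists_invariant_gaussian`). The variables of this process are vectors of the
Koopman representation with the same Gram matrix as the orbit, up to the factor `2`, so the bound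
for the Koopman representation gives the bound for `π` (`norm_groupRingRep_apply_le_of_gram`).
-/

/-! ### Representations of the full group C*-algebra -/

section GroupCStarReps

open UniformSpace

variable {G : Type u} [Group G]

theorem norm_unitary_le_one {H : Type v} [NormedAddCommGroup H] [InnerProductSpace ℂ H]
    [CompleteSpace H] (U : unitary (H →L[ℂ] H)) : ‖(U : H →L[ℂ] H)‖ ≤ 1 := by
  rcases subsingleton_or_nontrivial (H →L[ℂ] H) with h | h
  · simp [Subsingleton.elim (_ : H →L[ℂ] H) 0]
  · exact (CStarRing.norm_of_mem_unitary U.2).le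

namespace FullGroupCStar

variable {H : Type u} [NormedAddCommGroup H] [InnerProductSpace ℂ H] [CompleteSpace H]

theorem uniformContinuous_rep (ρ : G →* unitary (H →L[ℂ] H)) :
    UniformContinuous (GroupRing.rep ρ : GroupRing G → (H →L[ℂ] H)) :=
  ((GroupRing.rep ρ).toLinearMap.mkContinuous 1 fun φ => by
    rw [one_mul]; exact GroupRing.le_fullNorm' ρ φ).uniformContinuous

/-- The continuous extension to `C*(G)` of the extension to `ℂ[G]` of a unitary representation. -/
noncomputable def liftFun (ρ : G →* unitary (H →L[ℂ] H)) : FullGroupCStar G → (H →L[ℂ] H) :=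
  Completion.extension (GroupRing.rep ρ)

theorem liftFun_coe (ρ : G →* unitary (H →L[ℂ] H)) (φ : GroupRing G) :
    liftFun ρ (coe φ) = GroupRing.rep ρ φ :=
  Completion.extension_coe (uniformContinuous_rep ρ) φ

theorem continuous_liftFun (ρ : G →* unitary (H →L[ℂ] H)) : Continuous (liftFun ρ) :=
  Completion.continuous_extension

/-- The `*`-representation of `C*(G)` that extends a unitary representation of `G`. -/
noncomputable def lift (ρ : G →* unitary (H →L[ℂ] H)) :
    FullGroupCStar G →⋆ₙₐ[ℂ] (H →L[ℂ] H) where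
  toFun := liftFun ρ
  map_smul' c x := by
    refine induction_on (p := fun x => liftFun ρ (c • x) = c • liftFun ρ x) x
      (isClosed_eq ((continuous_liftFun ρ).comp (continuous_const_smul c))
        ((continuous_liftFun ρ).const_smul c)) fun φ => ?_
    rw [← coe_smul, liftFun_coe, liftFun_coe, map_smul]
  map_zero' := by
    have h : (0 : FullGroupCStar G) = coe 0 := Completion.coe_zero.symm
    rw [h, liftFun_coe, map_zero]
  map_add' x y := by
    refine induction_on₂ (p := fun x y => liftFun ρ (x + y) = liftFun ρ x + liftFun ρ y) x y
      (isClosed_eq ((continuous_liftFun ρ).comp continuous_add)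
        (((continuous_liftFun ρ).comp continuous_fst).add
          ((continuous_liftFun ρ).comp continuous_snd))) fun φ ψ => ?_
    rw [← coe_add, liftFun_coe, liftFun_coe, liftFun_coe, map_add]
  map_mul' x y := by
    refine induction_on₂ (p := fun x y => liftFun ρ (x * y) = liftFun ρ x * liftFun ρ y) x y
      (isClosed_eq ((continuous_liftFun ρ).comp continuous_mul)
        (((continuous_liftFun ρ).comp continuous_fst).mul
          ((continuous_liftFun ρ).comp continuous_snd))) fun φ ψ => ?_
    rw [← coe_mul, liftFun_coe, liftFun_coe, liftFun_coe, map_mul]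
  map_star' x := by
    refine induction_on (p := fun x => liftFun ρ (star x) = star (liftFun ρ x)) x
      (isClosed_eq ((continuous_liftFun ρ).comp continuous_star')
        (continuous_liftFun ρ).star) fun φ => ?_
    rw [star_coe, liftFun_coe, liftFun_coe, GroupRing.rep_star]

theorem lift_of (ρ : G →* unitary (H →L[ℂ] H)) (g : G) :
    lift ρ (of g) = (ρ g : H →L[ℂ] H) :=
  (liftFun_coe ρ _).trans (GroupRing.rep_of ρ g)

theorem of_mul (g h : G) : (of (g * h) : FullGroupCStar G) = of g * of h := by
  rw [of, GroupRing.of_mul, coe_mul]; rfl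

theorem of_one : (of 1 : FullGroupCStar G) = 1 := rfl

theorem star_of (g : G) : star (of g : FullGroupCStar G) = of g⁻¹ := by
  rw [of, star_coe, GroupRing.star_of]; rfl

theorem norm_of_le_one (g : G) : ‖(of g : FullGroupCStar G)‖ ≤ 1 := by
  rw [of, norm_coe]
  refine GroupRing.fullNorm_le' fun H _ _ _ ρ => ?_
  rw [GroupRing.rep_of]
  exact norm_unitary_le_one (ρ g)

end FullGroupCStar

/-- Evaluation of `φ ∈ ℂ[Γ]` at a family of operators indexed by `Γ`. -/
theorem groupRingRep_eq_sum {Γ : Type u} [Group Γ] {H : Type v} [NormedAddCommGroup H]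
    [InnerProductSpace ℂ H] [CompleteSpace H] (ρ : Γ →* unitary (H →L[ℂ] H))
    (φ : MonoidAlgebra ℂ Γ) :
    groupRingRep ρ φ = φ.coeff.sum fun g c => c • (ρ g : H →L[ℂ] H) := by
  rw [groupRingRep, MonoidAlgebra.lift_apply]; rfl

theorem toTensor_eq_sum (φ : MonoidAlgebra ℂ (G × G)) :
    toTensor G φ = φ.coeff.sum fun p c =>
      c • (FullGroupCStar.of p.1 ⊗ₜ[ℂ] FullGroupCStar.of p.2) := by
  rfl

end GroupCStarReps

/-! ### Comparison of the two tensor norms -/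

section TensorNormBounds

theorem opTensor_incl_tmul {H K : Type u} [NormedAddCommGroup H] [InnerProductSpace ℂ H]
    [NormedAddCommGroup K] [InnerProductSpace ℂ K] (S : H →L[ℂ] H) (T : K →L[ℂ] K) (a : H)
    (b : K) : opTensor S T (HilbertTensor.incl (a ⊗ₜ[ℂ] b)) =
      HilbertTensor.incl (S a ⊗ₜ[ℂ] T b) :=
  opTensor_incl S T _

theorem opTensor_mul {H K : Type u} [NormedAddCommGroup H] [InnerProductSpace ℂ H]
    [NormedAddCommGroup K] [InnerProductSpace ℂ K] (S S' : H →L[ℂ] H) (T T' : K →L[ℂ] K) :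
    opTensor (S * S') (T * T') = opTensor S T * opTensor S' T' :=
  hilbertTensor_ext fun x => by
    rw [mul_apply_eq_comp, opTensor_incl, opTensor_incl, opTensor_incl]
    induction x using TensorProduct.induction_on with
    | zero => simp
    | tmul a b => rfl
    | add x y hx hy => simp only [map_add, hx, hy]

theorem opTensor_star {H K : Type u} [NormedAddCommGroup H] [InnerProductSpace ℂ H]
    [NormedAddCommGroup K] [InnerProductSpace ℂ K] [CompleteSpace H] [CompleteSpace K]
    (S : H →L[ℂ] H) (T : K →L[ℂ] K) :
    opTensor (star S) (star T) = star (opTensor S T) := by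
  rw [ContinuousLinearMap.star_eq_adjoint (opTensor S T), ContinuousLinearMap.eq_adjoint_iff]
  intro x y
  refine HilbertTensor.induction_on (p := fun x => inner ℂ (opTensor (star S) (star T) x) y =
    inner ℂ x (opTensor S T y)) x (isClosed_eq (by fun_prop) (by fun_prop)) fun x => ?_
  refine HilbertTensor.induction_on (p := fun y => inner ℂ (opTensor (star S) (star T)
    (HilbertTensor.incl x)) y = inner ℂ (HilbertTensor.incl x) (opTensor S T y)) y
    (isClosed_eq (by fun_prop) (by fun_prop)) fun y => ?_
  rw [opTensor_incl, opTensor_incl, LinearIsometry.inner_map_map, LinearIsometry.inner_map_map]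
  induction x using TensorProduct.induction_on with
  | zero => simp
  | add x x' hx hx' => simp only [map_add, inner_add_left, hx, hx']
  | tmul a b =>
    induction y using TensorProduct.induction_on with
    | zero => simp
    | add y y' hy hy' => simp only [map_add, inner_add_right, hy, hy']
    | tmul c d =>
      change inner ℂ ((star S) a ⊗ₜ[ℂ] (star T) b) (c ⊗ₜ[ℂ] d) =
        inner ℂ (a ⊗ₜ[ℂ] b) (S c ⊗ₜ[ℂ] T d)
      simp only [TensorProduct.inner_tmul, ContinuousLinearMap.star_eq_adjoint,
        ContinuousLinearMap.adjoint_inner_left]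

variable {A B : Type u} [NonUnitalCStarAlgebra A] [NonUnitalCStarAlgebra B]

/-- The minimal norm is dominated by the maximal one: `α ⊗ 1` and `1 ⊗ β` commute. -/
theorem minTensorNorm_le_maxTensorNorm (t : A ⊗[ℂ] B) : minTensorNorm t ≤ maxTensorNorm t := by
  refine csSup_le (minTensorNorms_nonempty_bddAbove t).1 ?_
  rintro r ⟨H, _, _, _, K, _, _, _, α, β, rfl⟩
  let α' : A →⋆ₙₐ[ℂ] (HilbertTensor H K →L[ℂ] HilbertTensor H K) :=
    { toFun a := opTensor (α a) 1
      map_smul' c a := by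
        rw [map_smul]
        exact (opTensorₗ.flip (1 : K →L[ℂ] K)).map_smul c (α a)
      map_zero' := by
        rw [map_zero]
        exact (opTensorₗ.flip (1 : K →L[ℂ] K)).map_zero
      map_add' a b := by
        rw [map_add]
        exact (opTensorₗ.flip (1 : K →L[ℂ] K)).map_add (α a) (α b)
      map_mul' a b := by rw [map_mul, ← opTensor_mul, one_mul]
      map_star' a := by rw [map_star, ← opTensor_star, star_one] }
  let β' : B →⋆ₙₐ[ℂ] (HilbertTensor H K →L[ℂ] HilbertTensor H K) :=
    { toFun b := opTensor 1 (β b)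
      map_smul' c a := by
        rw [map_smul]
        exact (opTensorₗ (1 : H →L[ℂ] H)).map_smul c (β a)
      map_zero' := by
        rw [map_zero]
        exact (opTensorₗ (1 : H →L[ℂ] H)).map_zero
      map_add' a b := by
        rw [map_add]
        exact (opTensorₗ (1 : H →L[ℂ] H)).map_add (β a) (β b)
      map_mul' a b := by rw [map_mul, ← opTensor_mul, one_mul]
      map_star' a := by rw [map_star, ← opTensor_star, star_one] }
  have h : spatialTensor α β t = algTensor α' β' t := by
    induction t using TensorProduct.induction_on with
    | zero => simp
    | add x y hx hy => rw [map_add, map_add, hx, hy]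
    | tmul a b =>
      change opTensor (α a) (β b) = opTensor (α a) 1 * opTensor 1 (β b)
      rw [← opTensor_mul, one_mul, mul_one]
  rw [h]
  refine le_csSup (maxTensorNorms_nonempty_bddAbove t).2 ⟨_, _, _, _, α', β', fun a b => ?_, rfl⟩
  change opTensor (α a) 1 * opTensor 1 (β b) = opTensor 1 (β b) * opTensor (α a) 1
  rw [← opTensor_mul, ← opTensor_mul, one_mul, mul_one, one_mul, mul_one]

variable {G : Type u} [Group G]

theorem norm_sum_opTensor_le_minTensorNorm {H K : Type u} [NormedAddCommGroup H]
    [InnerProductSpace ℂ H] [CompleteSpace H] [NormedAddCommGroup K] [InnerProductSpace ℂ K]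
    [CompleteSpace K] (ρ : G →* unitary (H →L[ℂ] H)) (σ : G →* unitary (K →L[ℂ] K))
    (φ : MonoidAlgebra ℂ (G × G)) :
    ‖φ.coeff.sum fun p c => c • opTensor (ρ p.1 : H →L[ℂ] H) (σ p.2 : K →L[ℂ] K)‖ ≤
      minTensorNorm (toTensor G φ) := by
  have h : spatialTensor (FullGroupCStar.lift ρ) (FullGroupCStar.lift σ) (toTensor G φ) =
      φ.coeff.sum fun p c => c • opTensor (ρ p.1 : H →L[ℂ] H) (σ p.2 : K →L[ℂ] K) := by
    rw [toTensor_eq_sum, Finsupp.sum, Finsupp.sum, map_sum]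
    refine Finset.sum_congr rfl fun p _ => ?_
    rw [map_smul, ← FullGroupCStar.lift_of ρ, ← FullGroupCStar.lift_of σ]
    rfl
  rw [← h]
  exact le_csSup (minTensorNorms_nonempty_bddAbove _).2 ⟨H, _, _, _, K, _, _, _, _, _, rfl⟩

/-- A `*`-representation of `C*(G)`, possibly degenerate, restricted to `G` and made unitary by
letting `G` act trivially on the orthogonal complement of the essential subspace. -/
noncomputable def unitaryOfStarHom {H : Type v} [NormedAddCommGroup H] [InnerProductSpace ℂ H]
    [CompleteSpace H] (α : FullGroupCStar G →⋆ₙₐ[ℂ] (H →L[ℂ] H)) :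
    G →* unitary (H →L[ℂ] H) where
  toFun g := ⟨α (FullGroupCStar.of g) + (1 - α 1), by
    rw [Unitary.mem_iff]
    have h1 : ∀ g : G, α (FullGroupCStar.of g) * α 1 = α (FullGroupCStar.of g) := fun g => by
      rw [← map_mul, mul_one]
    have h2 : ∀ g : G, α 1 * α (FullGroupCStar.of g) = α (FullGroupCStar.of g) := fun g => by
      rw [← map_mul, one_mul]
    have h3 : ∀ g h : G, α (FullGroupCStar.of g) * α (FullGroupCStar.of h) =
        α (FullGroupCStar.of (g * h)) := fun g h => by rw [← map_mul, FullGroupCStar.of_mul]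
    have h4 : α 1 * α 1 = α 1 := by rw [← map_mul, one_mul]
    have h5 : star (α (FullGroupCStar.of g) + (1 - α 1)) =
        α (FullGroupCStar.of g⁻¹) + (1 - α 1) := by
      rw [star_add, star_sub, star_one, ← map_star, ← map_star, star_one, FullGroupCStar.star_of]
    rw [h5]
    simp only [add_mul, mul_add, sub_mul, mul_sub, one_mul, mul_one, h1, h2, h3, h4,
      inv_mul_cancel, mul_inv_cancel, FullGroupCStar.of_one]
    constructor <;> abel⟩
  map_one' := by
    ext1
    change α (FullGroupCStar.of 1) + (1 - α 1) = 1
    rw [FullGroupCStar.of_one]; abel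
  map_mul' g h := by
    ext1
    change α (FullGroupCStar.of (g * h)) + (1 - α 1) =
      (α (FullGroupCStar.of g) + (1 - α 1)) * (α (FullGroupCStar.of h) + (1 - α 1))
    have h1 : α (FullGroupCStar.of g) * α 1 = α (FullGroupCStar.of g) := by
      rw [← map_mul, mul_one]
    have h2 : α 1 * α (FullGroupCStar.of h) = α (FullGroupCStar.of h) := by
      rw [← map_mul, one_mul]
    have h4 : α 1 * α 1 = α 1 := by rw [← map_mul, one_mul]
    rw [FullGroupCStar.of_mul, map_mul]
    simp only [add_mul, mul_add, sub_mul, mul_sub, one_mul, mul_one, h1, h2, h4]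
    abel

/-- The maximal norm of an element of `ℂ[G × G]` is at most the supremum of its norms in the
unitary representations of `G × G`. -/
theorem maxTensorNorm_le_of_forall_rep {φ : MonoidAlgebra ℂ (G × G)} {C : ℝ}
    (h : ∀ (H : Type u) [NormedAddCommGroup H] [InnerProductSpace ℂ H] [CompleteSpace H]
      (ρ : G × G →* unitary (H →L[ℂ] H)), ‖groupRingRep ρ φ‖ ≤ C) :
    maxTensorNorm (toTensor G φ) ≤ C := by
  refine csSup_le (maxTensorNorms_nonempty_bddAbove _).1 ?_
  rintro r ⟨H, _, _, _, α, β, hαβ, rfl⟩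
  have hcomm : ∀ g h : G, Commute (unitaryOfStarHom α g) (unitaryOfStarHom β h) := by
    intro g h
    ext1
    have h1 : Commute (α (FullGroupCStar.of g) + (1 - α 1)) (β (FullGroupCStar.of h)) :=
      (hαβ _ _).add_left ((Commute.one_left _).sub_left (hαβ _ _))
    have h2 : Commute (α (FullGroupCStar.of g) + (1 - α 1)) (β 1) :=
      (hαβ _ _).add_left ((Commute.one_left _).sub_left (hαβ _ _))
    exact h1.add_right ((Commute.one_right _).sub_right h2)
  let ρ : G × G →* unitary (H →L[ℂ] H) :=
    MonoidHom.noncommCoprod (unitaryOfStarHom α) (unitaryOfStarHom β) hcomm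
  -- On the range of the projection `α 1 * β 1` the two representations agree.
  have key : algTensor α β (toTensor G φ) = groupRingRep ρ φ * (α 1 * β 1) := by
    rw [toTensor_eq_sum, groupRingRep_eq_sum, Finsupp.sum, Finsupp.sum, map_sum, Finset.sum_mul]
    refine Finset.sum_congr rfl fun p _ => ?_
    rw [map_smul, smul_mul_assoc]
    congr 1
    change α (FullGroupCStar.of p.1) * β (FullGroupCStar.of p.2) =
      ((α (FullGroupCStar.of p.1) + (1 - α 1)) * (β (FullGroupCStar.of p.2) + (1 - β 1))) *
        (α 1 * β 1)
    have h1 : (α (FullGroupCStar.of p.1) + (1 - α 1)) * α 1 = α (FullGroupCStar.of p.1) := by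
      rw [add_mul, sub_mul, one_mul, ← map_mul, ← map_mul, mul_one, mul_one]; abel
    have h2 : (β (FullGroupCStar.of p.2) + (1 - β 1)) * β 1 = β (FullGroupCStar.of p.2) := by
      rw [add_mul, sub_mul, one_mul, ← map_mul, ← map_mul, mul_one, mul_one]; abel
    have h3 : (β (FullGroupCStar.of p.2) + (1 - β 1)) * α 1 =
        α 1 * (β (FullGroupCStar.of p.2) + (1 - β 1)) :=
      ((hαβ _ _).add_right ((Commute.one_right _).sub_right (hαβ _ _))).symm
    rw [mul_assoc, ← mul_assoc _ (α 1), h3, mul_assoc, h2, ← mul_assoc, h1]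
  have hα : ‖α 1‖ ≤ 1 := (NonUnitalStarAlgHom.norm_apply_le α 1).trans
    (FullGroupCStar.of_one (G := G) ▸ FullGroupCStar.norm_of_le_one 1)
  have hβ : ‖β 1‖ ≤ 1 := (NonUnitalStarAlgHom.norm_apply_le β 1).trans
    (FullGroupCStar.of_one (G := G) ▸ FullGroupCStar.norm_of_le_one 1)
  rw [key]
  calc ‖groupRingRep ρ φ * (α 1 * β 1)‖ ≤ ‖groupRingRep ρ φ‖ * (‖α 1‖ * ‖β 1‖) :=
        (norm_mul_le _ _).trans (mul_le_mul_of_nonneg_left (norm_mul_le _ _) (norm_nonneg _))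
    _ ≤ ‖groupRingRep ρ φ‖ * 1 := mul_le_mul_of_nonneg_left
        (mul_le_one₀ hα (norm_nonneg _) hβ) (norm_nonneg _)
    _ ≤ C := by rw [mul_one]; exact h H ρ

end TensorNormBounds

/-! ### Vectors with equal Gram matrices -/

section Gram

variable {ι : Type*} {H K : Type*} [NormedAddCommGroup H] [InnerProductSpace ℂ H]
  [NormedAddCommGroup K] [InnerProductSpace ℂ K]

/-- The Gram matrix of a family of vectors determines the norms of their linear combinations. -/
theorem norm_linearCombination_eq_of_gram {p : ι → H} {q : ι → K} {c : ℝ} (hc : 0 ≤ c)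
    (h : ∀ i j, inner ℂ (p i) (p j) = (c : ℂ) ^ 2 * inner ℂ (q i) (q j)) (x : ι →₀ ℂ) :
    ‖Finsupp.linearCombination ℂ p x‖ = c * ‖Finsupp.linearCombination ℂ q x‖ := by
  have key : inner ℂ (Finsupp.linearCombination ℂ p x) (Finsupp.linearCombination ℂ p x) =
      (c : ℂ) ^ 2 *
        inner ℂ (Finsupp.linearCombination ℂ q x) (Finsupp.linearCombination ℂ q x) := by
    simp only [Finsupp.linearCombination_apply, Finsupp.sum, sum_inner, inner_sum,
      inner_smul_left, inner_smul_right, h, Finset.mul_sum]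
    refine Finset.sum_congr rfl fun i _ => Finset.sum_congr rfl fun j _ => by ring
  have key' : ‖Finsupp.linearCombination ℂ p x‖ ^ 2 =
      (c * ‖Finsupp.linearCombination ℂ q x‖) ^ 2 := by
    rw [mul_pow, @norm_sq_eq_re_inner ℂ, @norm_sq_eq_re_inner ℂ, key, ← Complex.ofReal_pow]
    exact Complex.re_ofReal_mul _ _
  exact (pow_left_inj₀ (norm_nonneg _) (by positivity) two_ne_zero).mp key'

theorem groupRingRep_apply {Γ : Type*} [Group Γ] [CompleteSpace H]
    (ρ : Γ →* unitary (H →L[ℂ] H)) (φ : MonoidAlgebra ℂ Γ) (v : H) :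
    groupRingRep ρ φ v =
      Finsupp.linearCombination ℂ (fun g => (ρ g : H →L[ℂ] H) v) φ.coeff := by
  rw [groupRingRep, MonoidAlgebra.lift_apply, Finsupp.linearCombination_apply, Finsupp.sum,
    Finsupp.sum, sum_apply]
  rfl

/-- If a unitary representation and a family of operators permute two families of vectors with
the same Gram matrix in the same way, and the first family is total, then the norms of the
elements of the group ring in the representation are dominated by those in the family. -/
theorem norm_groupRingRep_le_of_gram {Γ : Type*} [Group Γ] [CompleteSpace H]
    (ρ : Γ →* unitary (H →L[ℂ] H)) (T : Γ → K →L[ℂ] K) (act : Γ → ι → ι) {p : ι → H} {q : ι → K}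
    (hpq : ∀ i j, inner ℂ (p i) (p j) = inner ℂ (q i) (q j))
    (hρ : ∀ g i, (ρ g : H →L[ℂ] H) (p i) = p (act g i)) (hT : ∀ g i, T g (q i) = q (act g i))
    (hp : Dense (Submodule.span ℂ (Set.range p) : Set H)) (φ : MonoidAlgebra ℂ Γ) :
    ‖groupRingRep ρ φ‖ ≤ ‖φ.coeff.sum fun g c => c • T g‖ := by
  have hn : ∀ x : ι →₀ ℂ, ‖Finsupp.linearCombination ℂ p x‖ =
      ‖Finsupp.linearCombination ℂ q x‖ := fun x => by
    simpa using norm_linearCombination_eq_of_gram (p := p) (q := q) zero_le_one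
      (by simpa using hpq) x
  have hn' : ∀ x : ι →₀ ℂ, ‖groupRingRep ρ φ (Finsupp.linearCombination ℂ p x)‖ ≤
      ‖φ.coeff.sum fun g c => c • T g‖ * ‖Finsupp.linearCombination ℂ p x‖ := by
    intro x
    let y : ι →₀ ℂ := φ.coeff.sum fun g c => c • x.mapDomain (act g)
    have h1 : groupRingRep ρ φ (Finsupp.linearCombination ℂ p x) =
        Finsupp.linearCombination ℂ p y := by
      have : ∀ g, (ρ g : H →L[ℂ] H) (Finsupp.linearCombination ℂ p x) =
          Finsupp.linearCombination ℂ p (x.mapDomain (act g)) := fun g => by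
        rw [Finsupp.linearCombination_mapDomain, Finsupp.linearCombination_apply,
          Finsupp.linearCombination_apply, Finsupp.sum, Finsupp.sum, map_sum]
        exact Finset.sum_congr rfl fun i _ => by rw [map_smul, hρ]; rfl
      rw [groupRingRep_apply, Finsupp.linearCombination_apply]
      simp only [y, this, Finsupp.sum, map_sum, map_smul]
    have h2 : (φ.coeff.sum fun g c => c • T g) (Finsupp.linearCombination ℂ q x) =
        Finsupp.linearCombination ℂ q y := by
      have : ∀ g, T g (Finsupp.linearCombination ℂ q x) =
          Finsupp.linearCombination ℂ q (x.mapDomain (act g)) := fun g => by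
        rw [Finsupp.linearCombination_mapDomain, Finsupp.linearCombination_apply,
          Finsupp.linearCombination_apply, Finsupp.sum, Finsupp.sum, map_sum]
        exact Finset.sum_congr rfl fun i _ => by rw [map_smul, hT]; rfl
      simp only [y, Finsupp.sum, map_sum, map_smul, sum_apply,
        smul_apply, this]
    rw [h1, hn, ← h2, hn]
    exact ContinuousLinearMap.le_opNorm _ _
  refine ContinuousLinearMap.opNorm_le_bound _ (norm_nonneg _) fun v => ?_
  refine hp.induction (P := fun v => ‖groupRingRep ρ φ v‖ ≤
    ‖φ.coeff.sum fun g c => c • T g‖ * ‖v‖) (fun v hv => ?_)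
    (isClosed_le (by fun_prop) (by fun_prop)) v
  rw [SetLike.mem_coe, Finsupp.mem_span_range_iff_exists_finsupp] at hv
  obtain ⟨x, rfl⟩ := hv
  exact hn' x

end Gram

/-! ### The Koopman representation -/

section Koopman

variable {X : Type v} [mX : MeasurableSpace X] {μ : Measure X}

/-- The unitary operator `f ↦ f ∘ e⁻¹` of `L²(X, μ)`. -/
noncomputable def koopmanEquiv (e : MPEquiv μ) : Lp ℂ 2 μ ≃ₗᵢ[ℂ] Lp ℂ 2 μ where
  toFun := Lp.compMeasurePreserving e.1.symm (e.2.symm e.1)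
  invFun := Lp.compMeasurePreserving e.1 e.2
  left_inv f := by
    rw [← Lp.compMeasurePreserving_comp_apply]
    convert Lp.compMeasurePreserving_id_apply f
    ext x; simp
  right_inv f := by
    rw [← Lp.compMeasurePreserving_comp_apply]
    convert Lp.compMeasurePreserving_id_apply f
    ext x; simp
  map_add' := map_add _
  map_smul' c f := (Lp.compMeasurePreservingₗ ℂ e.1.symm (e.2.symm e.1)).map_smul c f
  norm_map' f := Lp.norm_compMeasurePreserving f _

theorem coeFn_koopmanEquiv (e : MPEquiv μ) (f : Lp ℂ 2 μ) :
    koopmanEquiv e f =ᵐ[μ] f ∘ e.1.symm :=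
  Lp.coeFn_compMeasurePreserving f (e.2.symm e.1)

theorem MPEquiv.symm_ae_eq {e f : MPEquiv μ} (h : (e.1 : X → X) =ᵐ[μ] f.1) :
    (e.1.symm : X → X) =ᵐ[μ] f.1.symm := by
  have h1 : (fun x => e.1 (e.1.symm x)) =ᵐ[μ] fun x => f.1 (e.1.symm x) :=
    (e.2.symm e.1).quasiMeasurePreserving.ae_eq_comp h
  filter_upwards [h1] with x hx
  have hx' : x = f.1 (e.1.symm x) := by simpa using hx
  exact (f.1.symm_apply_eq.mpr hx').symm

/-- The Koopman representation of `Aut(X, μ)` on `L²(X, μ)`. -/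
noncomputable def koopman : Aut μ →* unitary (Lp ℂ 2 μ →L[ℂ] Lp ℂ 2 μ) :=
  (Unitary.linearIsometryEquiv (𝕜 := ℂ) (H := Lp ℂ 2 μ)).symm.toMonoidHom.comp
  { toFun := Quotient.lift koopmanEquiv <| by
      intro e f h
      ext1 v
      refine Lp.ext ?_
      refine (coeFn_koopmanEquiv e v).trans (EventuallyEq.trans ?_ (coeFn_koopmanEquiv f v).symm)
      exact EventuallyEq.fun_comp (MPEquiv.symm_ae_eq h) v
    map_one' := by
      ext1 v
      refine Lp.ext ?_
      exact coeFn_koopmanEquiv (⟨MeasurableEquiv.refl X, MeasurePreserving.id μ⟩ : MPEquiv μ) v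
    map_mul' := by
      rintro ⟨e⟩ ⟨f⟩
      ext1 v
      refine Lp.ext ?_
      change koopmanEquiv (⟨f.1.trans e.1, e.2.comp f.2⟩ : MPEquiv μ) v =ᵐ[μ]
        koopmanEquiv e (koopmanEquiv f v)
      refine (coeFn_koopmanEquiv _ v).trans (EventuallyEq.symm ?_)
      refine (coeFn_koopmanEquiv _ _).trans ?_
      exact (e.2.symm e.1).quasiMeasurePreserving.ae_eq_comp (coeFn_koopmanEquiv f v) }

theorem coeFn_koopman_mk (e : X ≃ᵐ X) (he : MeasurePreserving e μ μ) (f : Lp ℂ 2 μ) :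
    (koopman (Aut.mk e he) : Lp ℂ 2 μ →L[ℂ] Lp ℂ 2 μ) f =ᵐ[μ] f ∘ e.symm :=
  coeFn_koopmanEquiv ⟨e, he⟩ f

/-- The indicator function of `D` as a vector of `L²(X, μ)`. -/
noncomputable abbrev indicatorL2 (μ : Measure X) [IsFiniteMeasure μ] {D : Set X}
    (hD : MeasurableSet D) : Lp ℂ 2 μ :=
  indicatorConstLp 2 hD (measure_ne_top μ D) 1

theorem koopman_mk_indicator [IsFiniteMeasure μ] (e : X ≃ᵐ X) (he : MeasurePreserving e μ μ)
    {D : Set X} (hD : MeasurableSet D) :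
    (koopman (Aut.mk e he) : Lp ℂ 2 μ →L[ℂ] Lp ℂ 2 μ)
      (indicatorL2 μ hD) =
    indicatorL2 μ (e.symm.measurable hD) :=
  Lp.indicatorConstLp_compMeasurePreserving hD (measure_ne_top μ D) 1 (he.symm e)

theorem norm_koopman_apply (T : Aut μ) (f : Lp ℂ 2 μ) :
    ‖(koopman T : Lp ℂ 2 μ →L[ℂ] Lp ℂ 2 μ) f‖ = ‖f‖ :=
  ((Unitary.linearIsometryEquiv (koopman T))).norm_map f

theorem inner_indicatorConstLp_one [IsFiniteMeasure μ] {D E : Set X} (hD : MeasurableSet D)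
    (hE : MeasurableSet E) :
    inner ℂ (indicatorL2 μ hD)
      (indicatorL2 μ hE) = μ.real (D ∩ E) :=
  L2.inner_indicatorConstLp_one_indicatorConstLp_one ..

theorem norm_indicatorConstLp_sub [IsFiniteMeasure μ] {D E : Set X} (hD : MeasurableSet D)
    (hE : MeasurableSet E) :
    ‖indicatorL2 μ hD -
      indicatorL2 μ hE‖ ^ 2 = μ.real (D ∆ E) := by
  have h : ∀ {S T : Set X} (hS : MeasurableSet S) (hT : MeasurableSet T),
      RCLike.re (inner ℂ (indicatorL2 μ hS)
        (indicatorL2 μ hT)) = μ.real (S ∩ T) := fun hS hT => by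
    rw [inner_indicatorConstLp_one]; rfl
  have h1 : μ.real (D ∆ E) = μ.real (D \ E) + μ.real (E \ D) :=
    measureReal_symmDiff_eq hD hE
  have h2 : μ.real (D ∩ E) + μ.real (D \ E) = μ.real D := measureReal_inter_add_sdiff hE
  have h3 : μ.real (E ∩ D) + μ.real (E \ D) = μ.real E := measureReal_inter_add_sdiff hD
  rw [@norm_sub_sq ℂ, @norm_sq_eq_re_inner ℂ, @norm_sq_eq_re_inner ℂ, h, h, h, Set.inter_self,
    Set.inter_self]
  rw [Set.inter_comm E D] at h3
  linarith

/-- The indicator functions of the sets of a generating π-system are total in `L²`. -/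
theorem dense_span_indicator_of_piSystem [IsFiniteMeasure μ] {ι : Type*}
    (s : ι → Set X) (hs : ∀ i, MeasurableSet (s i))
    (hgen : mX = MeasurableSpace.generateFrom (Set.range s)) (hpi : IsPiSystem (Set.range s))
    (huniv : ∃ i, s i = Set.univ) :
    Dense (Submodule.span ℂ (Set.range fun i =>
      indicatorL2 μ (hs i)) :
      Set (Lp ℂ 2 μ)) := by
  rw [Submodule.dense_iff_topologicalClosure_eq_top,
    Submodule.topologicalClosure_eq_top_iff, Submodule.eq_bot_iff]
  intro f hf
  have hint : Integrable f μ := (Lp.memLp f).integrable one_le_two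
  have h0 : ∀ i, ∫ x in s i, f x ∂μ = 0 := fun i => by
    rw [← L2.inner_indicatorConstLp_one (𝕜 := ℂ) (hs i) (measure_ne_top μ _) f]
    exact hf _ (Submodule.subset_span ⟨i, rfl⟩)
  have hall : ∀ S : Set X, MeasurableSet S → ∫ x in S, f x ∂μ = 0 := by
    obtain ⟨i, hi⟩ := huniv
    have hu : ∫ x, f x ∂μ = 0 := by
      have := h0 i
      rwa [hi, Measure.restrict_univ] at this
    intro S hS
    induction S, hS using MeasurableSpace.induction_on_inter hgen hpi with
    | empty => simp
    | basic t ht =>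
      obtain ⟨j, rfl⟩ := ht
      exact h0 j
    | compl t ht ih =>
      rw [setIntegral_compl ht hint, ih, hu, sub_zero]
    | iUnion g hd hm ih =>
      rw [integral_iUnion hm hd hint.integrableOn]
      simp [ih]
  have := Integrable.ae_eq_zero_of_forall_setIntegral_eq_zero hint fun S hS _ => hall S hS
  exact (Lp.eq_zero_iff_ae_eq_zero).mpr this

end Koopman

/-! ### Synergodic actions -/

section ULift

/-- The inner product on the lift of an inner product space to a higher universe. -/
noncomputable instance innerProductSpaceULift {E : Type v} [NormedAddCommGroup E]
    [InnerProductSpace ℂ E] : InnerProductSpace ℂ (ULift.{u} E) where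
  inner x y := inner ℂ x.down y.down
  norm_sq_eq_re_inner x := norm_sq_eq_re_inner (𝕜 := ℂ) x.down
  conj_inner_symm x y := inner_conj_symm x.down y.down
  add_left x y z := inner_add_left x.down y.down z.down
  smul_left x y r := inner_smul_left x.down y.down r

/-- Unitary operators act on the lift of a Hilbert space to a higher universe. -/
noncomputable def unitaryULift (E : Type v) [NormedAddCommGroup E] [InnerProductSpace ℂ E]
    [CompleteSpace E] : unitary (E →L[ℂ] E) →* unitary (ULift.{u} E →L[ℂ] ULift.{u} E) :=
  Unitary.linearIsometryEquiv.symm.toMonoidHom.comp <| MonoidHom.comp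
    { toFun U := (LinearIsometryEquiv.ulift ℂ E).trans
        (U.trans (LinearIsometryEquiv.ulift ℂ E).symm)
      map_one' := rfl
      map_mul' _ _ := rfl } (Unitary.linearIsometryEquiv (𝕜 := ℂ) (H := E)).toMonoidHom

theorem unitaryULift_apply {E : Type v} [NormedAddCommGroup E] [InnerProductSpace ℂ E]
    [CompleteSpace E] (U : unitary (E →L[ℂ] E)) (v : E) :
    (unitaryULift.{u} E U : ULift.{u} E →L[ℂ] ULift.{u} E)
      ((LinearIsometryEquiv.ulift ℂ E).symm v) =
    (LinearIsometryEquiv.ulift ℂ E).symm ((U : E →L[ℂ] E) v) := rfl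

end ULift

section Invariant

variable {X : Type v} [mX : MeasurableSpace X] {μ : Measure X}

theorem isInvariant_iff_koopman [IsFiniteMeasure μ] (T : Aut μ) {D : Set X}
    (hD : MeasurableSet D) :
    T.IsInvariant D ↔
      (koopman T : Lp ℂ 2 μ →L[ℂ] Lp ℂ 2 μ) (indicatorL2 μ hD) = indicatorL2 μ hD := by
  obtain ⟨⟨e, he⟩, rfl⟩ := Quotient.exists_rep T
  change (Aut.mk e he).IsInvariant D ↔ (koopman (Aut.mk e he) : Lp ℂ 2 μ →L[ℂ] Lp ℂ 2 μ) _ = _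
  rw [Aut.isInvariant_mk, koopman_mk_indicator]
  rw [e.image_eq_preimage_symm]
  exact (indicatorConstLp_inj _ (measure_ne_top μ _) hD (measure_ne_top μ _) one_ne_zero).symm

theorem koopman_mul_apply (S T : Aut μ) (v : Lp ℂ 2 μ) :
    (koopman (S * T) : Lp ℂ 2 μ →L[ℂ] Lp ℂ 2 μ) v =
      (koopman S : Lp ℂ 2 μ →L[ℂ] Lp ℂ 2 μ) ((koopman T : Lp ℂ 2 μ →L[ℂ] Lp ℂ 2 μ) v) := by
  rw [map_mul]; rfl

theorem koopman_one_apply (v : Lp ℂ 2 μ) :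
    (koopman (1 : Aut μ) : Lp ℂ 2 μ →L[ℂ] Lp ℂ 2 μ) v = v := by
  rw [map_one]; rfl

theorem inner_koopman_left (S : Aut μ) (v w : Lp ℂ 2 μ) :
    inner ℂ ((koopman S : Lp ℂ 2 μ →L[ℂ] Lp ℂ 2 μ) v) w =
      inner ℂ v ((koopman S⁻¹ : Lp ℂ 2 μ →L[ℂ] Lp ℂ 2 μ) w) := by
  have h : w = (koopman S : Lp ℂ 2 μ →L[ℂ] Lp ℂ 2 μ)
      ((koopman S⁻¹ : Lp ℂ 2 μ →L[ℂ] Lp ℂ 2 μ) w) := by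
    rw [← koopman_mul_apply, mul_inv_cancel, koopman_one_apply]
  conv_lhs => rw [h]
  exact (Unitary.linearIsometryEquiv (koopman S)).inner_map_map _ _

/-- The functions in `L²` which are fixed by an ergodic action are constant. -/
theorem exists_eq_smul_of_isErgodic [IsProbabilityMeasure μ] {Γ : Type u} [Group Γ]
    {A : Γ →* Aut μ} (hA : Act.IsErgodic (A : Act Γ μ)) (v : Lp ℂ 2 μ)
    (hv : ∀ g, (koopman (A g) : Lp ℂ 2 μ →L[ℂ] Lp ℂ 2 μ) v = v) :
    ∃ c : ℂ, v = c • indicatorL2 μ MeasurableSet.univ := by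
  have hvm : Measurable v := (Lp.stronglyMeasurable v).measurable
  obtain ⟨c, hc⟩ : ∃ c : ℂ, v =ᵐ[μ] Function.const X c := by
    refine Filter.exists_eventuallyEq_const_of_forall_separating MeasurableSet fun U hU => ?_
    have hinv : MeasurableSet[Act.invariants A] (v ⁻¹' U) := by
      refine ⟨hvm hU, fun g => ?_⟩
      have hg := hv g
      obtain ⟨⟨e, he⟩, h⟩ := Quotient.exists_rep (A g)
      rw [← h] at hg ⊢
      refine (Aut.isInvariant_mk he).mpr ?_
      rw [e.image_eq_preimage_symm]
      have h1 := coeFn_koopman_mk e he v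
      have h2 : v ∘ e.symm =ᵐ[μ] v := h1.symm.trans (by
        rw [show (koopman (Aut.mk e he) : Lp ℂ 2 μ →L[ℂ] Lp ℂ 2 μ) v = v from hg])
      filter_upwards [h2] with x hx
      exact congrArg (· ∈ U) hx
    rcases ((hA _).mp hinv).2 with h | h
    · right
      exact measure_eq_zero_iff_ae_notMem.mp h
    · left
      exact (mem_ae_iff_prob_eq_one (hvm hU)).mpr h
  refine ⟨c, Lp.ext ?_⟩
  refine hc.trans (EventuallyEq.symm ?_)
  refine (Lp.coeFn_smul c _).trans ?_
  filter_upwards [indicatorConstLp_coeFn (μ := μ) (p := 2) (hs := MeasurableSet.univ)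
    (hμs := measure_ne_top μ _) (c := (1 : ℂ))] with x hx
  rw [Pi.smul_apply, hx]
  simp

end Invariant

section Synergodic

variable {X : Type v} [mX : MeasurableSpace X] {μ : Measure X}
  {G : Type u} [Group G] (A : G × G →* Aut μ)

/-- The space of the functions that are fixed by the first factor of `G × G`. -/
noncomputable def fixedByFst : Submodule ℂ (Lp ℂ 2 μ) where
  carrier := {v | ∀ g : G, (koopman (A (g, 1)) : Lp ℂ 2 μ →L[ℂ] Lp ℂ 2 μ) v = v}
  zero_mem' g := map_zero _
  add_mem' hv hw g := by rw [map_add, hv g, hw g]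
  smul_mem' c v hv g := by rw [map_smul, hv g]

instance : CompleteSpace (fixedByFst A) := by
  have h : (fixedByFst A : Set (Lp ℂ 2 μ)) =
      ⋂ g : G, {v | (koopman (A (g, 1)) : Lp ℂ 2 μ →L[ℂ] Lp ℂ 2 μ) v = v} := by
    ext v; simp [fixedByFst]
  have hc : IsClosed (fixedByFst A : Set (Lp ℂ 2 μ)) := by
    rw [h]
    exact isClosed_iInter fun g => isClosed_eq (by fun_prop) (by fun_prop)
  exact hc.completeSpace_coe

variable {A}

theorem koopman_snd_mem_fixedByFst {v : Lp ℂ 2 μ} (hv : v ∈ fixedByFst A) (h : G) :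
    (koopman (A (1, h)) : Lp ℂ 2 μ →L[ℂ] Lp ℂ 2 μ) v ∈ fixedByFst A := fun g => by
  rw [← koopman_mul_apply, ← map_mul, Prod.mk_mul_mk, one_mul, mul_one]
  conv_rhs => rw [← hv g, ← koopman_mul_apply, ← map_mul, Prod.mk_mul_mk, one_mul, mul_one]

theorem koopman_prod_apply (g h : G) (v : Lp ℂ 2 μ) :
    (koopman (A (g, h)) : Lp ℂ 2 μ →L[ℂ] Lp ℂ 2 μ) v =
      (koopman (A (g, 1)) : Lp ℂ 2 μ →L[ℂ] Lp ℂ 2 μ)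
        ((koopman (A (1, h)) : Lp ℂ 2 μ →L[ℂ] Lp ℂ 2 μ) v) := by
  rw [← koopman_mul_apply, ← map_mul, Prod.mk_mul_mk, one_mul, mul_one]

theorem koopman_prod_apply' (g h : G) (v : Lp ℂ 2 μ) :
    (koopman (A (g, h)) : Lp ℂ 2 μ →L[ℂ] Lp ℂ 2 μ) v =
      (koopman (A (1, h)) : Lp ℂ 2 μ →L[ℂ] Lp ℂ 2 μ)
        ((koopman (A (g, 1)) : Lp ℂ 2 μ →L[ℂ] Lp ℂ 2 μ) v) := by
  rw [← koopman_mul_apply, ← map_mul, Prod.mk_mul_mk, one_mul, mul_one]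

variable [IsProbabilityMeasure μ]

/-- For an ergodic action of `G × G`, the sets that are invariant under the first factor are
independent of those that are invariant under the second one: the projection of the indicator
function of a set of the latter kind to the functions fixed by the first factor is fixed by
`G × G`, hence constant. -/
theorem measureReal_inter_of_isErgodic (hA : Act.IsErgodic (A : Act (G × G) μ)) {D E : Set X}
    (hD : MeasurableSet D) (hE : MeasurableSet E) (hDi : ∀ g : G, (A (g, 1)).IsInvariant D)
    (hEi : ∀ g : G, (A (1, g)).IsInvariant E) : μ.real (D ∩ E) = μ.real D * μ.real E := by
  set w := (fixedByFst A).starProjection (indicatorL2 μ hE) with hw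
  have hwm : w ∈ fixedByFst A := Submodule.starProjection_apply_mem _ _
  have hsnd : ∀ h : G, (koopman (A (1, h)) : Lp ℂ 2 μ →L[ℂ] Lp ℂ 2 μ) w = w := fun h => by
    refine (Submodule.eq_starProjection_of_mem_of_inner_eq_zero
      (koopman_snd_mem_fixedByFst hwm h) fun z hz => ?_).symm
    have h1 : (koopman (A (1, h)) : Lp ℂ 2 μ →L[ℂ] Lp ℂ 2 μ) (indicatorL2 μ hE) =
        indicatorL2 μ hE := (isInvariant_iff_koopman _ hE).mp (hEi h)
    rw [← h1, ← map_sub, inner_koopman_left, ← map_inv, Prod.inv_mk, inv_one]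
    exact Submodule.starProjection_inner_eq_zero _ _ (koopman_snd_mem_fixedByFst hz h⁻¹)
  obtain ⟨c, hc⟩ := exists_eq_smul_of_isErgodic hA w fun p => by
    have : p = (p.1, 1) * (1, p.2) := by simp
    rw [this, map_mul, koopman_mul_apply, hsnd, hwm p.1]
  have key : ∀ S : Set X, ∀ hS : MeasurableSet S, (∀ g : G, (A (g, 1)).IsInvariant S) →
      (μ.real (S ∩ E) : ℂ) = c * μ.real S := fun S hS hSi => by
    have hmem : indicatorL2 μ hS ∈ fixedByFst A := fun g =>
      (isInvariant_iff_koopman _ hS).mp (hSi g)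
    have h1 := Submodule.starProjection_inner_eq_zero (indicatorL2 μ hE) _ hmem
    have h2 : inner ℂ (indicatorL2 μ hS) (indicatorL2 μ hE) = inner ℂ (indicatorL2 μ hS) w := by
      rw [inner_sub_left, sub_eq_zero] at h1
      rw [← inner_conj_symm, h1, inner_conj_symm]
    rw [inner_indicatorConstLp_one, hc, inner_smul_right, inner_indicatorConstLp_one,
      Set.inter_univ] at h2
    exact h2
  have huniv := key Set.univ MeasurableSet.univ fun g =>
    (((hA Set.univ).mpr ⟨MeasurableSet.univ, Or.inr measure_univ⟩).2 (g, 1))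
  have hDE := key D hD hDi
  rw [Set.univ_inter, probReal_univ, Complex.ofReal_one, mul_one] at huniv
  rw [← huniv] at hDE
  rw [mul_comm]
  exact_mod_cast hDE

end Synergodic

section SynergodicBound

variable {X : Type} [mX : MeasurableSpace X] {μ : Measure X} [IsProbabilityMeasure μ]
  {G : Type u} [Group G]

/-- The vectors `1_(D ∩ E)` with `D` invariant under the first and `E` invariant under the second
factor of a synergodic action are total, and by independence they have the same Gram matrix as the
vectors `1_E ⊗ 1_D`, which `G × G` permutes in the same way: `G × G` acts on `E` through its first
and on `D` through its second factor. The space `H` is a copy of `L²(X, μ)` in the universe of `G`,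
as `minTensorNorm` is a supremum over Hilbert spaces in that universe. -/
theorem norm_koopman_le_of_isSynergodic_aux {H : Type u} [NormedAddCommGroup H]
    [InnerProductSpace ℂ H] [CompleteSpace H] (J : Lp ℂ 2 μ ≃ₗᵢ[ℂ] H)
    (κ : Aut μ →* unitary (H →L[ℂ] H))
    (hκ : ∀ T v, (κ T : H →L[ℂ] H) (J v) = J ((koopman T : Lp ℂ 2 μ →L[ℂ] Lp ℂ 2 μ) v))
    (A : Act (G × G) μ) (hA : A.IsSynergodic)
    (φ : MonoidAlgebra ℂ (G × G)) :
    ‖groupRingRep (koopman.comp (A : G × G →* Aut μ)) φ‖ ≤ minTensorNorm (toTensor G φ) := by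
  obtain ⟨hA, hgen⟩ := hA
  let B : G × G →* Aut μ := A
  have hrep : ∀ p : G × G, ∃ e : MPEquiv μ, B p = Aut.mk e.1 e.2 := fun p => by
    obtain ⟨e, he⟩ := Quotient.exists_rep (B p)
    exact ⟨e, he.symm⟩
  choose e he using hrep
  let ι : Type := {p : Set X × Set X // MeasurableSet[Act.invariants (Act.fst A)] p.1 ∧
    MeasurableSet[Act.invariants (Act.snd A)] p.2}
  have hι₁ : ∀ i : ι, MeasurableSet i.1.1 := fun i => i.2.1.1
  have hι₂ : ∀ i : ι, MeasurableSet i.1.2 := fun i => i.2.2.1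
  have hfix₁ : ∀ (i : ι) (g : G), (koopman (B (g, 1)) : Lp ℂ 2 μ →L[ℂ] Lp ℂ 2 μ)
      (indicatorL2 μ (hι₁ i)) = indicatorL2 μ (hι₁ i) := fun i g =>
    (isInvariant_iff_koopman _ _).mp (i.2.1.2 g)
  have hfix₂ : ∀ (i : ι) (g : G), (koopman (B (1, g)) : Lp ℂ 2 μ →L[ℂ] Lp ℂ 2 μ)
      (indicatorL2 μ (hι₂ i)) = indicatorL2 μ (hι₂ i) := fun i g =>
    (isInvariant_iff_koopman _ _).mp (i.2.2.2 g)
  have hk : ∀ (p : G × G) {D : Set X} (hD : MeasurableSet D),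
      (koopman (B p) : Lp ℂ 2 μ →L[ℂ] Lp ℂ 2 μ) (indicatorL2 μ hD) =
        indicatorL2 μ ((e p).1.symm.measurable hD) := fun p D hD => by
    rw [he p]; exact koopman_mk_indicator _ _ hD
  -- The action of `G × G` on the pairs of invariant sets, up to null sets.
  let act : G × G → ι → ι := fun p i =>
    ⟨((e (1, p.2)).1.symm ⁻¹' i.1.1, (e (p.1, 1)).1.symm ⁻¹' i.1.2), by
      refine ⟨⟨(e (1, p.2)).1.symm.measurable (hι₁ i), fun g => ?_⟩,
        ⟨(e (p.1, 1)).1.symm.measurable (hι₂ i), fun g => ?_⟩⟩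
      · refine (isInvariant_iff_koopman (B (g, 1)) ((e (1, p.2)).1.symm.measurable (hι₁ i))).mpr ?_
        rw [← hk, ← koopman_prod_apply, koopman_prod_apply', hfix₁]
      · refine (isInvariant_iff_koopman (B (1, g)) ((e (p.1, 1)).1.symm.measurable (hι₂ i))).mpr ?_
        rw [← hk, ← koopman_prod_apply', koopman_prod_apply, hfix₂]⟩
  have hact₁ : ∀ p i, (koopman (B (1, p.2)) : Lp ℂ 2 μ →L[ℂ] Lp ℂ 2 μ) (indicatorL2 μ (hι₁ i)) =
      indicatorL2 μ (hι₁ (act p i)) := fun p i => hk _ _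
  have hact₂ : ∀ p i, (koopman (B (p.1, 1)) : Lp ℂ 2 μ →L[ℂ] Lp ℂ 2 μ) (indicatorL2 μ (hι₂ i)) =
      indicatorL2 μ (hι₂ (act p i)) := fun p i => hk _ _
  have hind : ∀ {D E : Set X}, MeasurableSet[Act.invariants (Act.fst A)] D →
      MeasurableSet[Act.invariants (Act.snd A)] E →
      μ.real (D ∩ E) = μ.real D * μ.real E := fun hD hE =>
    measureReal_inter_of_isErgodic (A := B) hA hD.1 hE.1 hD.2 hE.2
  let p : ι → Lp ℂ 2 μ := fun i => indicatorL2 μ ((hι₁ i).inter (hι₂ i))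
  let q : ι → HilbertTensor H H := fun i =>
    HilbertTensor.incl (J (indicatorL2 μ (hι₂ i)) ⊗ₜ[ℂ] J (indicatorL2 μ (hι₁ i)))
  let ρ₁ : G →* unitary (H →L[ℂ] H) :=
    κ.comp (B.comp (MonoidHom.inl G G))
  let ρ₂ : G →* unitary (H →L[ℂ] H) :=
    κ.comp (B.comp (MonoidHom.inr G G))
  have hρ₁ : ∀ g, ρ₁ g = κ (B (g, 1)) := fun _ => rfl
  have hρ₂ : ∀ g, ρ₂ g = κ (B (1, g)) := fun _ => rfl
  have hgram : ∀ i j, inner ℂ (p i) (p j) = inner ℂ (q i) (q j) := fun i j => by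
    simp only [p, q]
    rw [LinearIsometry.inner_map_map, TensorProduct.inner_tmul, J.inner_map_map, J.inner_map_map,
      inner_indicatorConstLp_one, inner_indicatorConstLp_one, inner_indicatorConstLp_one,
      Set.inter_inter_inter_comm, hind (i.2.1.inter j.2.1) (i.2.2.inter j.2.2)]
    push_cast
    ring
  have hp : ∀ g i, ((koopman.comp B) g : Lp ℂ 2 μ →L[ℂ] Lp ℂ 2 μ) (p i) = p (act g i) :=
      fun g i => by
    have hind₁ : (koopman (B g) : Lp ℂ 2 μ →L[ℂ] Lp ℂ 2 μ) (indicatorL2 μ (hι₁ i)) =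
        indicatorL2 μ (hι₁ (act g i)) := by
      rw [← hact₁, koopman_prod_apply', hfix₁]
    have hind₂ : (koopman (B g) : Lp ℂ 2 μ →L[ℂ] Lp ℂ 2 μ) (indicatorL2 μ (hι₂ i)) =
        indicatorL2 μ (hι₂ (act g i)) := by
      rw [← hact₂, koopman_prod_apply, hfix₂]
    rw [hk, indicatorConstLp_inj _ (measure_ne_top μ _) _ (measure_ne_top μ _) one_ne_zero]
      at hind₁ hind₂
    change (koopman (B g) : Lp ℂ 2 μ →L[ℂ] Lp ℂ 2 μ) (indicatorL2 μ _) = indicatorL2 μ _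
    rw [hk, indicatorConstLp_inj _ (measure_ne_top μ _) _ (measure_ne_top μ _) one_ne_zero]
    exact hind₁.inter hind₂
  have hq : ∀ (g : G × G) i, opTensor (ρ₁ g.1 : H →L[ℂ] H) (ρ₂ g.2 : H →L[ℂ] H) (q i) =
      q (act g i) := fun g i => by
    rw [show q i = HilbertTensor.incl (J (indicatorL2 μ (hι₂ i)) ⊗ₜ[ℂ] J (indicatorL2 μ (hι₁ i)))
      from rfl, opTensor_incl_tmul, hρ₁, hρ₂, hκ, hκ, hact₁, hact₂]
  have hdense : Dense (Submodule.span ℂ (Set.range p) : Set (Lp ℂ 2 μ)) := by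
    refine dense_span_indicator_of_piSystem (fun i : ι => i.1.1 ∩ i.1.2) _ ?_ ?_
      ⟨⟨(Set.univ, Set.univ), MeasurableSet.univ, MeasurableSet.univ⟩, Set.univ_inter _⟩
    · refine le_antisymm ?_ (MeasurableSpace.generateFrom_le ?_)
      · refine hgen.ge.trans (sup_le (fun D hD => ?_) (fun E hE => ?_))
        · exact MeasurableSpace.measurableSet_generateFrom
            ⟨⟨(D, Set.univ), hD, MeasurableSet.univ⟩, Set.inter_univ _⟩
        · exact MeasurableSpace.measurableSet_generateFrom
            ⟨⟨(Set.univ, E), MeasurableSet.univ, hE⟩, Set.univ_inter _⟩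
      · rintro _ ⟨i, rfl⟩
        exact (hι₁ i).inter (hι₂ i)
    · rintro _ ⟨i, rfl⟩ _ ⟨j, rfl⟩ -
      exact ⟨⟨(i.1.1 ∩ j.1.1, i.1.2 ∩ j.1.2), i.2.1.inter j.2.1, i.2.2.inter j.2.2⟩,
        Set.inter_inter_inter_comm _ _ _ _⟩
  have h := norm_groupRingRep_le_of_gram (koopman.comp B)
    (fun g => opTensor (ρ₁ g.1 : H →L[ℂ] H) (ρ₂ g.2 : H →L[ℂ] H)) act hgram hp hq hdense φ
  exact h.trans (norm_sum_opTensor_le_minTensorNorm ρ₁ ρ₂ φ)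

/-- The norm of `φ` in the Koopman representation of a synergodic action is at most its minimal
tensor norm. -/
theorem norm_koopman_le_of_isSynergodic (A : Act (G × G) μ) (hA : A.IsSynergodic)
    (φ : MonoidAlgebra ℂ (G × G)) :
    ‖groupRingRep (koopman.comp (A : G × G →* Aut μ)) φ‖ ≤ minTensorNorm (toTensor G φ) :=
  norm_koopman_le_of_isSynergodic_aux (LinearIsometryEquiv.ulift ℂ (Lp ℂ 2 μ)).symm
    ((unitaryULift.{u} (Lp ℂ 2 μ)).comp koopman) (fun T v => unitaryULift_apply (koopman T) v)
    A hA φ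

end SynergodicBound

/-! ### Ergodic actions of richly synergodic groups -/

section Continuity

variable {X : Type v} [mX : MeasurableSpace X] {μ : Measure X}

theorem continuous_imageDist {D : Set X} (hD : MeasurableSet D) (S : Aut μ) :
    Continuous fun T : Aut μ => Aut.imageDist D T S :=
  continuous_iInf_dom (i := ⟨D, hD⟩) (continuous_iInf_dom (i := S) continuous_induced_dom)

variable [IsFiniteMeasure μ]

theorem norm_koopman_sub_indicator (S T : Aut μ) {D : Set X} (hD : MeasurableSet D) :
    ‖(koopman S : Lp ℂ 2 μ →L[ℂ] Lp ℂ 2 μ) (indicatorL2 μ hD) -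
      (koopman T : Lp ℂ 2 μ →L[ℂ] Lp ℂ 2 μ) (indicatorL2 μ hD)‖ ^ 2 =
    (Aut.imageDist D S T).toReal := by
  obtain ⟨⟨e, he⟩, rfl⟩ := Quotient.exists_rep S
  obtain ⟨⟨f, hf⟩, rfl⟩ := Quotient.exists_rep T
  change ‖(koopman (Aut.mk e he) : Lp ℂ 2 μ →L[ℂ] Lp ℂ 2 μ) (indicatorL2 μ hD) -
    (koopman (Aut.mk f hf) : Lp ℂ 2 μ →L[ℂ] Lp ℂ 2 μ) (indicatorL2 μ hD)‖ ^ 2 =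
    (Aut.imageDist D (Aut.mk e he) (Aut.mk f hf)).toReal
  rw [koopman_mk_indicator, koopman_mk_indicator, norm_indicatorConstLp_sub, Aut.imageDist_mk,
    e.image_eq_preimage_symm, f.image_eq_preimage_symm]
  rfl

/-- The Koopman representation is strongly continuous for the weak topology. -/
theorem continuous_koopman_apply (v : Lp ℂ 2 μ) :
    Continuous fun T : Aut μ => (koopman T : Lp ℂ 2 μ →L[ℂ] Lp ℂ 2 μ) v := by
  let W : Submodule ℂ (Lp ℂ 2 μ) :=
    { carrier := {v | Continuous fun T : Aut μ => (koopman T : Lp ℂ 2 μ →L[ℂ] Lp ℂ 2 μ) v}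
      zero_mem' := by simpa using continuous_const
      add_mem' hv hw := by
        simp only [Set.mem_ofPred_eq, map_add] at hv hw ⊢
        exact hv.add hw
      smul_mem' c v hv := by
        simp only [Set.mem_ofPred_eq, map_smul] at hv ⊢
        exact hv.const_smul c }
  have hind : ∀ {D : Set X} (hD : MeasurableSet D), indicatorL2 μ hD ∈ W := fun {D} hD => by
    refine continuous_iff_continuousAt.mpr fun T => ?_
    rw [ContinuousAt, tendsto_iff_norm_sub_tendsto_zero]
    have h1 : Tendsto (fun S : Aut μ => Aut.imageDist D S T) (𝓝 T)
        (𝓝 (Aut.imageDist D T T)) := (continuous_imageDist hD T).continuousAt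
    have h0 : Aut.imageDist D T T = 0 := by
      obtain ⟨⟨e, he⟩, rfl⟩ := Quotient.exists_rep T
      change Aut.imageDist D (Aut.mk e he) (Aut.mk e he) = 0
      simp
    rw [h0] at h1
    have h2 := ((ENNReal.tendsto_toReal ENNReal.zero_ne_top).comp h1).sqrt
    simp only [Function.comp_def, ← norm_koopman_sub_indicator _ _ hD, ENNReal.toReal_zero,
      Real.sqrt_zero, Real.sqrt_sq (norm_nonneg _)] at h2
    exact h2
  have hr : Set.range (Subtype.val : {D : Set X // MeasurableSet D} → Set X) =
      {D | MeasurableSet D} := Subtype.range_coe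
  have hdense : Dense (W : Set (Lp ℂ 2 μ)) := by
    refine (dense_span_indicator_of_piSystem (μ := μ) (Subtype.val : {D // MeasurableSet D} → Set X)
      (fun D => D.2) ?_ ?_ ⟨⟨Set.univ, MeasurableSet.univ⟩, rfl⟩).mono ?_
    · rw [hr]
      exact MeasurableSpace.generateFrom_measurableSet.symm
    · rw [hr]
      exact MeasurableSpace.isPiSystem_measurableSet
    · refine Submodule.span_le.mpr ?_
      rintro _ ⟨D, rfl⟩
      exact hind D.2
  refine continuous_of_uniform_approx_of_continuous fun U hU => ?_
  obtain ⟨ε, hε, hU⟩ := Metric.mem_uniformity_dist.mp hU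
  obtain ⟨w, hw, hvw⟩ := Metric.dense_iff.mp hdense v ε hε
  refine ⟨_, hvw, fun T => hU ?_⟩
  rw [dist_eq_norm, ← map_sub, norm_koopman_apply, ← dist_eq_norm, dist_comm]
  exact hw

theorem continuous_groupRingRep_koopman_apply {Γ : Type u} [Group Γ] (φ : MonoidAlgebra ℂ Γ)
    (v : Lp ℂ 2 μ) :
    Continuous fun A : Act Γ μ => groupRingRep (koopman.comp (A : Γ →* Aut μ)) φ v := by
  simp only [groupRingRep_apply, Finsupp.linearCombination_apply, Finsupp.sum]
  refine continuous_finsetSum _ fun g _ => ?_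
  have h : Continuous fun A : Act Γ μ => DFunLike.coe (F := Γ →* Aut μ) A g :=
    (continuous_apply g).comp continuous_induced_dom
  exact ((continuous_koopman_apply v).comp h).const_smul (φ.coeff g)

end Continuity

section Rich

variable {X : Type} [MeasurableSpace X] [StandardBorelSpace X] {μ : Measure X}
  [IsProbabilityMeasure μ] [NullSingletonClass μ] {G : Type u} [Group G]

/-- Synergodic actions are dense among the ergodic ones, and the bound on the norm of `φ` is a closed
condition on the action because the Koopman representation is strongly continuous. -/
theorem norm_koopman_le_of_isErgodic (hG : RichlySynergodic G) (A : Act (G × G) μ)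
    (hA : A.IsErgodic) (φ : MonoidAlgebra ℂ (G × G)) :
    ‖groupRingRep (koopman.comp (A : G × G →* Aut μ)) φ‖ ≤ minTensorNorm (toTensor G φ) := by
  have h0 : 0 ≤ minTensorNorm (toTensor G φ) :=
    (norm_nonneg _).trans (norm_sum_opTensor_le_minTensorNorm
      (H := EuclideanSpace ℂ PEmpty.{u + 1}) (K := EuclideanSpace ℂ PEmpty.{u + 1}) 1 1 φ)
  refine ContinuousLinearMap.opNorm_le_bound _ h0 fun v => ?_
  refine (hG X μ).induction (P := fun A : Act.erg (G × G) μ =>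
    ‖groupRingRep (koopman.comp (A.1 : G × G →* Aut μ)) φ v‖ ≤
      minTensorNorm (toTensor G φ) * ‖v‖) (fun A hA => ?_)
    (isClosed_le ((continuous_groupRingRep_koopman_apply φ v).comp continuous_subtype_val).norm
      continuous_const) ⟨A, hA⟩
  exact (ContinuousLinearMap.le_opNorm _ _).trans
    (mul_le_mul_of_nonneg_right (norm_koopman_le_of_isSynergodic A.1 hA φ) (norm_nonneg _))

end Rich

/-! ### From ergodic measures to invariant measures -/

section KreinMilman

instance locallyConvexSpace_weakDual (E : Type*) [NormedAddCommGroup E] [NormedSpace ℝ E] :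
    LocallyConvexSpace ℝ (WeakDual ℝ E) :=
  inferInstanceAs (LocallyConvexSpace ℝ (WeakBilin (topDualPairing ℝ E)))

/-- A measure is extremal if the invariant measures below it are its multiples. For an invariant
probability measure this amounts to ergodicity. -/
def IsExtremalInvariant (Γ : Type*) [Group Γ] {Z : Type*} [MeasurableSpace Z] [MulAction Γ Z]
    (l : Measure Z) : Prop :=
  ∀ ν : Measure Z, ν ≤ l → SMulInvariantMeasure Γ Z ν → ν = ν Set.univ • l

theorem smulInvariantMeasure_cond {Γ : Type*} [Group Γ] {K : Type*} [MeasurableSpace K]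
    [MulAction Γ K] [MeasurableConstSMul Γ K] {μ : Measure K} [SMulInvariantMeasure Γ K μ]
    {s : Set K} (hs : ∀ g : Γ, (fun x => g • x) ⁻¹' s =ᵐ[μ] s) :
    SMulInvariantMeasure Γ K (ProbabilityTheory.cond μ s) := by
  refine ⟨fun g t ht => ?_⟩
  have hm : Measurable fun x : K => g • x := measurable_const_smul g
  rw [ProbabilityTheory.cond, Measure.smul_apply, Measure.smul_apply,
    Measure.restrict_apply (hm ht), Measure.restrict_apply ht]
  congr 1
  calc μ ((fun x => g • x) ⁻¹' t ∩ s)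
      = μ ((fun x => g • x) ⁻¹' t ∩ (fun x => g • x) ⁻¹' s) :=
        measure_congr ((ae_eq_refl _).inter (hs g).symm)
    _ = μ ((fun x => g • x) ⁻¹' (t ∩ s)) := rfl
    _ = μ (t ∩ s) := measure_preimage_smul μ g _

/-- Conditioning on an invariant set does not change the image in a system whose measure is
extremal. -/
theorem map_cond_eq {Γ : Type*} [Group Γ] {K : Type*} [MeasurableSpace K] [MulAction Γ K]
    [MeasurableConstSMul Γ K] {Z : Type*} [MeasurableSpace Z] [MulAction Γ Z]
    [MeasurableConstSMul Γ Z] {p : K → Z} (hpm : Measurable p)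
    (hp : ∀ (g : Γ) (x : K), p (g • x) = g • p x)
    {l : Measure Z} [IsProbabilityMeasure l] (hl : IsExtremalInvariant Γ l) {μ : Measure K}
    [IsProbabilityMeasure μ] [SMulInvariantMeasure Γ K μ] (hμ : μ.map p = l) {s : Set K}
    (hs : ∀ g : Γ, (fun x => g • x) ⁻¹' s =ᵐ[μ] s) (hs0 : μ s ≠ 0) :
    (ProbabilityTheory.cond μ s).map p = l := by
  have hinv := smulInvariantMeasure_cond (Γ := Γ) hs
  have hle : μ s • (ProbabilityTheory.cond μ s).map p ≤ l := by
    rw [← hμ, ← Measure.map_smul, ProbabilityTheory.cond, smul_smul,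
      ENNReal.mul_inv_cancel hs0 (measure_ne_top μ s), one_smul]
    exact Measure.map_mono Measure.restrict_le_self hpm
  have hinv' : SMulInvariantMeasure Γ Z (μ s • (ProbabilityTheory.cond μ s).map p) := by
    refine ⟨fun g t ht => ?_⟩
    rw [Measure.smul_apply, Measure.smul_apply, Measure.map_apply hpm ht,
      Measure.map_apply hpm (measurable_const_smul g ht), ← Set.preimage_comp]
    congr 1
    have : (fun z => g • z) ∘ p = p ∘ fun x => g • x := funext fun x => (hp g x).symm
    rw [this, Set.preimage_comp]
    exact measure_preimage_smul _ g _
  have hpr : IsProbabilityMeasure (ProbabilityTheory.cond μ s) :=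
    ProbabilityTheory.cond_isProbabilityMeasure hs0
  have h := hl _ hle hinv'
  rw [Measure.smul_apply, Measure.map_apply hpm MeasurableSet.univ, Set.preimage_univ,
    measure_univ, smul_eq_mul, mul_one] at h
  have h' := congrArg (fun ν : Measure Z => (μ s)⁻¹ • ν) h
  simpa only [smul_smul, ENNReal.inv_mul_cancel hs0 (measure_ne_top μ s), one_smul] using h'

variable {Γ : Type*} [Group Γ] {K : Type*} [TopologicalSpace K] [MulAction Γ K]
  [ContinuousConstSMul Γ K] {Z : Type*} [TopologicalSpace Z] [MeasurableSpace Z]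

/-- The translate of a continuous function. -/
def smulComp (g : Γ) {E : Type*} [TopologicalSpace E] (f : C(K, E)) : C(K, E) :=
  f.comp ⟨fun x => g • x, continuous_const_smul g⟩

variable (Γ) in
/-- The functionals of the invariant probability measures whose image under `p` is `l`. -/
def invariantFunctionals (p : C(K, Z)) (l : Measure Z) : Set (WeakDual ℝ C(K, ℝ)) :=
  {L | (∀ f : C(K, ℝ), 0 ≤ f → 0 ≤ L f) ∧ L 1 = 1 ∧
    (∀ (g : Γ) (f : C(K, ℝ)), L (smulComp g f) = L f) ∧
    ∀ f : C(Z, ℝ), L (f.comp p) = ∫ z, f z ∂l}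

theorem convex_invariantFunctionals (p : C(K, Z)) (l : Measure Z) :
    Convex ℝ (invariantFunctionals Γ p l) := by
  rintro L ⟨h1, h2, h3, h4⟩ L' ⟨h1', h2', h3', h4'⟩ a b ha hb hab
  have happ : ∀ f, (a • L + b • L') f = a * L f + b * L' f := fun f => rfl
  refine ⟨fun f hf => ?_, ?_, fun g f => ?_, fun f => ?_⟩
  · rw [happ]
    exact add_nonneg (mul_nonneg ha (h1 f hf)) (mul_nonneg hb (h1' f hf))
  · rw [happ, h2, h2', mul_one, mul_one, hab]
  · rw [happ, happ, h3, h3']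
  · rw [happ, h4, h4', ← add_mul, hab, one_mul]

variable [CompactSpace K]

theorem isCompact_invariantFunctionals (p : C(K, Z)) (l : Measure Z) :
    IsCompact (invariantFunctionals Γ p l) := by
  have hev : ∀ f : C(K, ℝ), Continuous fun L : WeakDual ℝ C(K, ℝ) => L f :=
    fun f => WeakDual.eval_continuous f
  refine (WeakDual.isCompact_closedBall (𝕜 := ℝ) (E := C(K, ℝ)) 0 1).of_isClosed_subset ?_ ?_
  · have c1 : IsClosed {L : WeakDual ℝ C(K, ℝ) | ∀ f : C(K, ℝ), 0 ≤ f → 0 ≤ L f} := by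
      simp only [Set.ofPred_forall]
      exact isClosed_iInter fun f => isClosed_iInter fun _ => isClosed_le continuous_const (hev f)
    have c2 : IsClosed {L : WeakDual ℝ C(K, ℝ) | L 1 = 1} := isClosed_eq (hev 1) continuous_const
    have c3 : IsClosed {L : WeakDual ℝ C(K, ℝ) |
        ∀ (g : Γ) (f : C(K, ℝ)), L (smulComp g f) = L f} := by
      simp only [Set.ofPred_forall]
      exact isClosed_iInter fun g => isClosed_iInter fun f => isClosed_eq (hev _) (hev f)
    have c4 : IsClosed {L : WeakDual ℝ C(K, ℝ) |
        ∀ f : C(Z, ℝ), L (f.comp p) = ∫ z, f z ∂l} := by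
      simp only [Set.ofPred_forall]
      exact isClosed_iInter fun f => isClosed_eq (hev _) continuous_const
    exact c1.inter (c2.inter (c3.inter c4))
  · rintro L ⟨h1, h2, -, -⟩
    rw [Set.mem_preimage, mem_closedBall_zero_iff]
    refine ContinuousLinearMap.opNorm_le_bound _ zero_le_one fun f => ?_
    have hc : L (‖f‖ • (1 : C(K, ℝ))) = ‖f‖ := by rw [map_smul, h2, smul_eq_mul, mul_one]
    have hle : ∀ x, |f x| ≤ ‖f‖ := fun x => f.norm_coe_le_norm x
    have hp : 0 ≤ L (‖f‖ • (1 : C(K, ℝ)) - f) := h1 _ fun x => by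
      simpa using (abs_le.mp (hle x)).2
    have hm : 0 ≤ L (‖f‖ • (1 : C(K, ℝ)) + f) := h1 _ fun x => by
      have := (abs_le.mp (hle x)).1
      change (0 : ℝ) ≤ ‖f‖ * 1 + f x
      linarith
    rw [map_sub, hc] at hp
    rw [map_add, hc] at hm
    rw [one_mul, Real.norm_eq_abs]
    exact abs_le.mpr ⟨by linarith [show (L.toStrongDual f) = L f from rfl],
      by linarith [show (L.toStrongDual f) = L f from rfl]⟩

variable [T2Space K] [SecondCountableTopology K] [MeasurableSpace K] [BorelSpace K]

theorem integrable_continuousMap (μ : Measure K) [IsFiniteMeasure μ] {E : Type*}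
    [NormedAddCommGroup E] (f : C(K, E)) [SecondCountableTopologyEither K E] : Integrable f μ :=
  f.continuous.integrable_of_hasCompactSupport (HasCompactSupport.of_compactSpace _)

theorem ext_of_forall_integral_continuousMap {μ ν : Measure K} [IsFiniteMeasure μ]
    [IsFiniteMeasure ν] (h : ∀ f : C(K, ℝ), ∫ x, f x ∂μ = ∫ x, f x ∂ν) : μ = ν :=
  ext_of_forall_integral_eq_of_IsFiniteMeasure fun f => h f.toContinuousMap

/-- Integration against a finite measure, as a functional on the continuous functions. -/
noncomputable def integralFunctional (μ : Measure K) [IsFiniteMeasure μ] :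
    WeakDual ℝ C(K, ℝ) :=
  StrongDual.toWeakDual <| LinearMap.mkContinuous
    { toFun := fun f : C(K, ℝ) => ∫ x, f x ∂μ
      map_add' := fun f g =>
        integral_add (integrable_continuousMap μ f) (integrable_continuousMap μ g)
      map_smul' := fun c f => integral_const_mul c f } (μ.real Set.univ) fun f => by
    rw [mul_comm]
    exact norm_integral_le_of_norm_le_const (Eventually.of_forall fun x => f.norm_coe_le_norm x)

theorem integralFunctional_apply (μ : Measure K) [IsFiniteMeasure μ] (f : C(K, ℝ)) :
    integralFunctional μ f = ∫ x, f x ∂μ := rfl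

theorem smulInvariantMeasure_of_integral {μ : Measure K} [IsFiniteMeasure μ]
    (h : ∀ (g : Γ) (f : C(K, ℝ)), ∫ x, f (g • x) ∂μ = ∫ x, f x ∂μ) :
    SMulInvariantMeasure Γ K μ := by
  refine ⟨fun g s hs => ?_⟩
  have hm : Measurable fun x : K => g • x := (continuous_const_smul g).measurable
  have : μ.map (fun x => g • x) = μ := ext_of_forall_integral_continuousMap fun f => by
    rw [integral_map hm.aemeasurable f.continuous.aestronglyMeasurable]
    exact h g f
  conv_rhs => rw [← this]
  rw [Measure.map_apply hm hs]

variable [BorelSpace Z]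

theorem integralFunctional_mem {p : C(K, Z)} {l : Measure Z} {μ : Measure K}
    [IsProbabilityMeasure μ] [SMulInvariantMeasure Γ K μ] (hp : μ.map p = l) :
    integralFunctional μ ∈ invariantFunctionals Γ p l := by
  refine ⟨fun f hf => integral_nonneg fun x => hf x, ?_, fun g f => ?_, fun f => ?_⟩
  · simp [integralFunctional_apply]
  · exact (measurePreserving_smul g μ).integral_comp
      (MeasurableEquiv.smul g).measurableEmbedding f
  · rw [← hp, integral_map p.continuous.measurable.aemeasurable
      f.continuous.aestronglyMeasurable]
    rfl

/-- If a set `s` contradicts ergodicity, then the measure is a proper convex combination of its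
conditional measures on `s` and on `sᶜ`, both of which have the same image `l`. -/
theorem ergodicSMul_of_mem_extremePoints [MulAction Γ Z] [MeasurableConstSMul Γ Z]
    {p : C(K, Z)}
    (hp : ∀ (g : Γ) (x : K), p (g • x) = g • p x)
    {l : Measure Z} [IsProbabilityMeasure l] (hl : IsExtremalInvariant Γ l) {μ : Measure K}
    [IsProbabilityMeasure μ] [SMulInvariantMeasure Γ K μ] (hμ : μ.map p = l)
    (hext : integralFunctional μ ∈ (invariantFunctionals Γ p l).extremePoints ℝ) :
    ErgodicSMul Γ K μ := by
  refine ⟨fun {s} hs hinv => ?_⟩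
  rw [Filter.eventuallyConst_set']
  by_contra! hcon
  have h0 : μ s ≠ 0 := fun h => hcon.1 (ae_eq_empty.mpr h)
  have h1 : μ sᶜ ≠ 0 := fun h => hcon.2 (ae_eq_univ.mpr h)
  have hinvc : ∀ g : Γ, (fun x => g • x) ⁻¹' sᶜ =ᵐ[μ] sᶜ := fun g => (hinv g).compl
  have hpr : IsProbabilityMeasure (ProbabilityTheory.cond μ s) :=
    ProbabilityTheory.cond_isProbabilityMeasure h0
  have hprc : IsProbabilityMeasure (ProbabilityTheory.cond μ sᶜ) :=
    ProbabilityTheory.cond_isProbabilityMeasure h1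
  have hi := smulInvariantMeasure_cond (Γ := Γ) hinv
  have hic := smulInvariantMeasure_cond (Γ := Γ) hinvc
  have hmem := integralFunctional_mem (Γ := Γ)
    (map_cond_eq p.continuous.measurable hp hl hμ hinv h0)
  have hmemc := integralFunctional_mem (Γ := Γ)
    (map_cond_eq p.continuous.measurable hp hl hμ hinvc h1)
  have hpos : 0 < μ.real s := ENNReal.toReal_pos h0 (measure_ne_top μ _)
  have hposc : 0 < μ.real sᶜ := ENNReal.toReal_pos h1 (measure_ne_top μ _)
  have hseg : integralFunctional μ ∈ openSegment ℝ
      (integralFunctional (ProbabilityTheory.cond μ s))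
      (integralFunctional (ProbabilityTheory.cond μ sᶜ)) := by
    refine ⟨μ.real s, μ.real sᶜ, hpos, hposc, by
      rw [measureReal_add_measureReal_compl hs, probReal_univ], ?_⟩
    refine DFunLike.ext _ _ fun f => ?_
    change μ.real s * ∫ x, f x ∂(ProbabilityTheory.cond μ s) +
      μ.real sᶜ * ∫ x, f x ∂(ProbabilityTheory.cond μ sᶜ) = ∫ x, f x ∂μ
    rw [ProbabilityTheory.cond, ProbabilityTheory.cond, integral_smul_measure,
      integral_smul_measure, ENNReal.toReal_inv, ENNReal.toReal_inv, smul_eq_mul, smul_eq_mul]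
    change μ.real s * ((μ.real s)⁻¹ * _) + μ.real sᶜ * ((μ.real sᶜ)⁻¹ * _) = _
    rw [mul_inv_cancel_left₀ hpos.ne', mul_inv_cancel_left₀ hposc.ne']
    exact integral_add_compl hs (integrable_continuousMap μ f)
  have heq := ((mem_extremePoints.mp hext).2 _ hmem _ hmemc hseg).1
  have hμeq : ProbabilityTheory.cond μ s = μ := ext_of_forall_integral_continuousMap fun f =>
    DFunLike.congr_fun heq f
  apply h1
  rw [← hμeq, ProbabilityTheory.cond_apply hs, Set.inter_compl_self, measure_empty, mul_zero]

variable [CompactSpace Z] [T2Space Z] [SecondCountableTopology Z]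

/-- The converse of `integralFunctional_mem`, by the Riesz–Markov–Kakutani theorem. -/
theorem exists_measure_of_mem_invariantFunctionals {p : C(K, Z)} {l : Measure Z}
    [IsProbabilityMeasure l] {L : WeakDual ℝ C(K, ℝ)} (hL : L ∈ invariantFunctionals Γ p l) :
    ∃ μ : Measure K, IsProbabilityMeasure μ ∧ SMulInvariantMeasure Γ K μ ∧ μ.map p = l ∧
      ∀ f : C(K, ℝ), L f = ∫ x, f x ∂μ := by
  obtain ⟨h1, h2, h3, h4⟩ := hL
  let L' : CompactlySupportedContinuousMap K ℝ →ₚ[ℝ] ℝ :=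
    { toFun f := L f.toContinuousMap
      map_add' f g := L.map_add f.toContinuousMap g.toContinuousMap
      map_smul' c f := L.map_smul c f.toContinuousMap
      monotone' f g hfg := by
        have := h1 (g.toContinuousMap - f.toContinuousMap) fun x => sub_nonneg.mpr (hfg x)
        rw [map_sub] at this
        exact sub_nonneg.mp this }
  have hint : ∀ f : C(K, ℝ), L f = ∫ x, f x ∂(RealRMK.rieszMeasure L') := fun f =>
    (RealRMK.integral_rieszMeasure L'
      (CompactlySupportedContinuousMap.continuousMapEquiv f)).symm
  have hprob : IsProbabilityMeasure (RealRMK.rieszMeasure L') := by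
    have h := hint 1
    rw [h2] at h
    simp only [ContinuousMap.one_apply, integral_const, smul_eq_mul, mul_one] at h
    refine ⟨?_⟩
    rw [← ENNReal.toReal_eq_one_iff]
    exact h.symm
  refine ⟨RealRMK.rieszMeasure L', hprob, smulInvariantMeasure_of_integral fun g f => ?_, ?_, hint⟩
  · rw [← hint f, ← h3 g f, hint]; rfl
  · have : IsProbabilityMeasure ((RealRMK.rieszMeasure L').map p) :=
      Measure.isProbabilityMeasure_map p.continuous.measurable.aemeasurable
    refine ext_of_forall_integral_continuousMap fun f => ?_
    rw [integral_map p.continuous.measurable.aemeasurable f.continuous.aestronglyMeasurable,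
      ← h4 f, hint]
    rfl

variable [MulAction Γ Z] [MeasurableConstSMul Γ Z]

/-- A linear inequality that holds for all ergodic measures above an extremal measure holds for
all invariant measures above it, by the Krein–Milman theorem. -/
theorem integral_nonneg_of_forall_ergodic {p : C(K, Z)}
    (hp : ∀ (g : Γ) (x : K), p (g • x) = g • p x)
    {l : Measure Z} [IsProbabilityMeasure l] (hl : IsExtremalInvariant Γ l) (f : C(K, ℝ))
    (hf : ∀ μ : Measure K, IsProbabilityMeasure μ → ErgodicSMul Γ K μ → μ.map p = l →
      0 ≤ ∫ x, f x ∂μ) {μ : Measure K}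
    [IsProbabilityMeasure μ] [SMulInvariantMeasure Γ K μ] (hμ : μ.map p = l) :
    0 ≤ ∫ x, f x ∂μ := by
  have hmem : integralFunctional μ ∈ invariantFunctionals Γ p l := integralFunctional_mem hμ
  rw [← closure_convexHull_extremePoints (isCompact_invariantFunctionals p l)
    (convex_invariantFunctionals p l)] at hmem
  have hclosed : IsClosed {L : WeakDual ℝ C(K, ℝ) | 0 ≤ L f} :=
    isClosed_le continuous_const (WeakDual.eval_continuous f)
  have hconv : Convex ℝ {L : WeakDual ℝ C(K, ℝ) | 0 ≤ L f} := by
    intro L hL L' hL' a b ha hb _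
    exact add_nonneg (mul_nonneg ha hL) (mul_nonneg hb hL')
  refine closure_minimal (convexHull_min (fun L hL => ?_) hconv) hclosed hmem
  obtain ⟨ν, hν, hνi, hνp, hLν⟩ := exists_measure_of_mem_invariantFunctionals hL.1
  have hLeq : integralFunctional ν = L := DFunLike.ext _ _ fun f => (hLν f).symm
  rw [← hLeq] at hL ⊢
  exact hf ν hν (ergodicSMul_of_mem_extremePoints hp hl hνp hL) hνp

end KreinMilman

/-! ### Koopman representations of invariant measures on compact spaces -/

section ActOfSMul

variable {Γ : Type u} [Group Γ] {K : Type v} [MeasurableSpace K] [MulAction Γ K]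
  [MeasurableConstSMul Γ K] (μ : Measure K) [SMulInvariantMeasure Γ K μ]

variable (Γ) in
/-- A measure preserving action on points as an element of `Act(Γ, K, μ)`. -/
noncomputable def actOfSMul : Γ →* Aut μ where
  toFun g := Aut.mk (MeasurableEquiv.smul g) (measurePreserving_smul g μ)
  map_one' := Quotient.sound (s := aeSetoid μ) (Eventually.of_forall fun x => one_smul Γ x)
  map_mul' g h := Quotient.sound (s := aeSetoid μ) (Eventually.of_forall fun x => mul_smul g h x)

variable {μ}

theorem isInvariant_actOfSMul_iff (g : Γ) (D : Set K) :
    (actOfSMul Γ μ g).IsInvariant D ↔ (fun x => g⁻¹ • x) ⁻¹' D =ᵐ[μ] D := by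
  refine (Aut.isInvariant_mk (e := MeasurableEquiv.smul g) (measurePreserving_smul g μ)).trans ?_
  rw [MeasurableEquiv.image_eq_preimage_symm]
  rfl

end ActOfSMul

theorem isErgodic_actOfSMul {Γ : Type u} [Group Γ] {K : Type v} [MeasurableSpace K]
    [MulAction Γ K] [MeasurableConstSMul Γ K] {μ : Measure K} [IsProbabilityMeasure μ]
    [ErgodicSMul Γ K μ] :
    Act.IsErgodic (actOfSMul Γ μ : Act Γ μ) := by
  intro D
  constructor
  · rintro ⟨hD, hinv⟩
    refine ⟨hD, ?_⟩
    have h : Filter.EventuallyConst D (ae μ) :=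
      ErgodicSMul.aeconst_of_forall_preimage_smul_ae_eq (G := Γ) hD fun g => by
        simpa using (isInvariant_actOfSMul_iff g⁻¹ D).mp (hinv g⁻¹)
    rcases Filter.eventuallyConst_set'.mp h with h | h
    · exact Or.inl (ae_eq_empty.mp h)
    · exact Or.inr ((measure_congr h).trans measure_univ)
  · rintro ⟨hD, h⟩
    refine ⟨hD, fun g => (isInvariant_actOfSMul_iff g D).mpr ?_⟩
    have hpre := measure_preimage_smul_of_nullMeasurableSet (μ := μ) hD.nullMeasurableSet g⁻¹
    rcases h with h | h
    · exact (ae_eq_empty.mpr (hpre.trans h)).trans (ae_eq_empty.mpr h).symm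
    · have h1 : ∀ {E : Set K}, MeasurableSet E → μ E = 1 → E =ᵐ[μ] Set.univ := fun hE h =>
        ae_eq_univ.mpr ((prob_compl_eq_zero_iff hE).mpr h)
      exact (h1 (measurable_const_smul g⁻¹ hD) (hpre.trans h)).trans (h1 hD h).symm

theorem norm_sq_eq_integral {K : Type v} [MeasurableSpace K] {μ : Measure K} (f : Lp ℂ 2 μ) :
    ‖f‖ ^ 2 = ∫ x, ‖f x‖ ^ 2 ∂μ := by
  have h : inner ℂ f f = ((∫ x, ‖f x‖ ^ 2 ∂μ : ℝ) : ℂ) := by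
    rw [L2.inner_def, ← integral_complex_ofReal]
    refine integral_congr_ae (Eventually.of_forall fun x => ?_)
    simp only [inner_self_eq_norm_sq_to_K]
    simp
  rw [@norm_sq_eq_re_inner ℂ, h]
  rfl

section Compact

variable {Γ : Type u} [Group Γ] {K : Type v} [TopologicalSpace K] [CompactSpace K]
  [MeasurableSpace K] [BorelSpace K] [MulAction Γ K]
  [ContinuousConstSMul Γ K]

/-- The convolution of an element of the group ring with a continuous function. -/
noncomputable def convolve (φ : MonoidAlgebra ℂ Γ) (f : C(K, ℂ)) : C(K, ℂ) :=
  φ.coeff.sum fun g c => c • smulComp g⁻¹ f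

theorem groupRingRep_toLp (μ : Measure K) [IsFiniteMeasure μ] [SMulInvariantMeasure Γ K μ]
    (φ : MonoidAlgebra ℂ Γ) (f : C(K, ℂ)) :
    groupRingRep (koopman.comp (actOfSMul Γ μ)) φ (ContinuousMap.toLp 2 μ ℂ f) =
      ContinuousMap.toLp 2 μ ℂ (convolve φ f) := by
  have h : ∀ g : Γ, (koopman (actOfSMul Γ μ g) : Lp ℂ 2 μ →L[ℂ] Lp ℂ 2 μ)
      (ContinuousMap.toLp 2 μ ℂ f) = ContinuousMap.toLp 2 μ ℂ (smulComp g⁻¹ f) := fun g => by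
    refine Lp.ext ?_
    refine (coeFn_koopman_mk _ (measurePreserving_smul g μ) _).trans ?_
    refine EventuallyEq.trans ?_ (ContinuousMap.coeFn_toLp μ _).symm
    exact (measurePreserving_smul g⁻¹ μ).quasiMeasurePreserving.ae_eq_comp
      (ContinuousMap.coeFn_toLp (p := 2) (𝕜 := ℂ) μ f)
  rw [groupRingRep_apply, Finsupp.linearCombination_apply, convolve, Finsupp.sum, Finsupp.sum,
    map_sum]
  refine Finset.sum_congr rfl fun g _ => ?_
  rw [map_smul, ← h]
  rfl

theorem norm_toLp_sq (μ : Measure K) [IsFiniteMeasure μ] (f : C(K, ℂ)) :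
    ‖ContinuousMap.toLp 2 μ ℂ f‖ ^ 2 = ∫ x, ‖f x‖ ^ 2 ∂μ := by
  rw [norm_sq_eq_integral]
  refine integral_congr_ae ?_
  filter_upwards [ContinuousMap.coeFn_toLp (p := 2) (𝕜 := ℂ) μ f] with x hx
  rw [hx]

/-- The function whose integral is nonnegative if and only if the norm of the convolution of `f`
with `φ` is at most `C` times the norm of `f`. -/
noncomputable def normDefect (φ : MonoidAlgebra ℂ Γ) (C : ℝ) (f : C(K, ℂ)) : C(K, ℝ) where
  toFun x := C ^ 2 * ‖f x‖ ^ 2 - ‖convolve φ f x‖ ^ 2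
  continuous_toFun := by fun_prop

variable [T2Space K] [SecondCountableTopology K]

theorem integral_normDefect (μ : Measure K) [IsFiniteMeasure μ] [SMulInvariantMeasure Γ K μ]
    (φ : MonoidAlgebra ℂ Γ) (C : ℝ) (f : C(K, ℂ)) :
    ∫ x, normDefect φ C f x ∂μ = (C * ‖ContinuousMap.toLp 2 μ ℂ f‖) ^ 2 -
      ‖groupRingRep (koopman.comp (actOfSMul Γ μ)) φ (ContinuousMap.toLp 2 μ ℂ f)‖ ^ 2 := by
  have hi : ∀ f : C(K, ℂ), Integrable (fun x => ‖f x‖ ^ 2) μ := fun f =>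
    integrable_continuousMap μ (⟨fun x => ‖f x‖ ^ 2, by fun_prop⟩ : C(K, ℝ))
  rw [mul_pow, groupRingRep_toLp, norm_toLp_sq, norm_toLp_sq, ← integral_const_mul]
  exact integral_sub ((hi f).const_mul _) (hi (convolve φ f))

end Compact

section InvariantBound

variable {G : Type u} [Group G] {K : Type} [TopologicalSpace K] [CompactSpace K]
  [T2Space K] [SecondCountableTopology K] [MeasurableSpace K] [BorelSpace K]
  [StandardBorelSpace K] [MulAction (G × G) K] [ContinuousConstSMul (G × G) K]
  {Z : Type*} [TopologicalSpace Z] [CompactSpace Z] [T2Space Z] [SecondCountableTopology Z]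
  [MeasurableSpace Z] [BorelSpace Z] [MulAction (G × G) Z] [ContinuousConstSMul (G × G) Z]

/-- For a richly synergodic group, the bound on the Koopman representations of ergodic actions
extends to all invariant measures on a compact space with a diffuse extremal factor. The ergodic
measures above this factor are diffuse, and the bound for a fixed continuous function is linear in
the measure. -/
theorem norm_koopman_le_of_factor (hG : RichlySynergodic G) {p : C(K, Z)}
    (hp : ∀ (g : G × G) (x : K), p (g • x) = g • p x) {l : Measure Z} [IsProbabilityMeasure l]
    [NullSingletonClass l] (hl : IsExtremalInvariant (G × G) l) {μ : Measure K}
    [IsProbabilityMeasure μ] [SMulInvariantMeasure (G × G) K μ] (hμ : μ.map p = l)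
    (φ : MonoidAlgebra ℂ (G × G)) :
    ‖groupRingRep (koopman.comp (actOfSMul (G × G) μ)) φ‖ ≤ minTensorNorm (toTensor G φ) := by
  set C := minTensorNorm (toTensor G φ) with hC
  have h0 : 0 ≤ C := (norm_nonneg _).trans (norm_sum_opTensor_le_minTensorNorm
    (H := EuclideanSpace ℂ PEmpty.{u + 1}) (K := EuclideanSpace ℂ PEmpty.{u + 1}) 1 1 φ)
  refine ContinuousLinearMap.opNorm_le_bound _ h0 fun v => ?_
  refine (ContinuousMap.toLp_denseRange ℂ μ ℂ (p := 2) (by simp)).induction_on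
    (p := fun v => ‖groupRingRep (koopman.comp (actOfSMul (G × G) μ)) φ v‖ ≤ C * ‖v‖) v
    (isClosed_le (by fun_prop) (by fun_prop)) fun f => ?_
  have hf : 0 ≤ ∫ x, normDefect φ C f x ∂μ := by
    refine integral_nonneg_of_forall_ergodic hp hl _ (fun ν hν hνe hνp => ?_) hμ
    have hna : NullSingletonClass ν := ⟨fun x => by
      refine measure_mono_null (t := p ⁻¹' {p x}) (fun y hy => by
        rw [Set.mem_singleton_iff.mp hy]; rfl) ?_
      rw [← Measure.map_apply p.continuous.measurable (measurableSet_singleton _), hνp]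
      exact measure_singleton _⟩
    rw [integral_normDefect, sub_nonneg]
    refine pow_le_pow_left₀ (norm_nonneg _) ?_ 2
    exact (ContinuousLinearMap.le_opNorm _ _).trans (mul_le_mul_of_nonneg_right
      (norm_koopman_le_of_isErgodic hG _ isErgodic_actOfSMul φ) (norm_nonneg _))
  rw [integral_normDefect, sub_nonneg] at hf
  exact (pow_le_pow_iff_left₀ (norm_nonneg _) (mul_nonneg h0 (norm_nonneg _)) two_ne_zero).mp hf

end InvariantBound

/-! ### Bernoulli shifts -/

section Averaging

variable {Z : Type*} [MeasurableSpace Z]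

/-- Let `E 0, E 1, …` be pairwise independent events of probability `p`. If they all have the same
measure for some measure `ν ≤ l`, then this measure is `p * ν univ`, because the averages of their
indicator functions converge to `p` in `L²(l)`, hence in `L²(ν)`. -/
theorem measureReal_eq_of_pairwise_independent {l ν : Measure Z} [IsProbabilityMeasure l]
    (hle : ν ≤ l) {E : ℕ → Set Z} (hE : ∀ k, MeasurableSet (E k)) {p q : ℝ}
    (hp : ∀ k, l.real (E k) = p) (hpp : ∀ j k, j ≠ k → l.real (E j ∩ E k) = p * p)
    (hq : ∀ k, ν.real (E k) = q) : q = p * ν.real Set.univ := by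
  have hfin : IsFiniteMeasure ν := isFiniteMeasure_of_le l hle
  have hν1 : ν.real Set.univ ≤ 1 := by
    have h : ν Set.univ ≤ 1 := (hle Set.univ).trans_eq (measure_univ (μ := l))
    exact ENNReal.toReal_mono ENNReal.one_ne_top h
  have hp0 : 0 ≤ p := hp 0 ▸ measureReal_nonneg
  have hp1 : p ≤ 1 := hp 0 ▸ measureReal_le_one
  let e : ℕ → Z → ℝ := fun k x => (E k).indicator 1 x - p
  have hem : ∀ k, Measurable (e k) := fun k =>
    (measurable_one.indicator (hE k)).sub_const p
  have heb : ∀ k x, |e k x| ≤ 1 := fun k x => by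
    rw [abs_le]
    by_cases hx : x ∈ E k <;> simp only [e, Set.indicator_of_mem, Set.indicator_of_notMem, hx,
      Pi.one_apply, not_false_eq_true] <;> constructor <;> linarith
  have hei : ∀ (μ : Measure Z) [IsFiniteMeasure μ] (k : ℕ), Integrable (e k) μ := fun μ _ k =>
    Integrable.of_bound (hem k).aestronglyMeasurable 1 (Eventually.of_forall (heb k))
  have heei : ∀ (μ : Measure Z) [IsFiniteMeasure μ] (j k : ℕ),
      Integrable (fun x => e j x * e k x) μ := fun μ _ j k =>
    Integrable.of_bound ((hem j).mul (hem k)).aestronglyMeasurable 1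
      (Eventually.of_forall fun x => by
        rw [Real.norm_eq_abs, abs_mul]
        exact mul_le_one₀ (heb j x) (abs_nonneg _) (heb k x))
  have hint : ∀ (μ : Measure Z) [IsFiniteMeasure μ] (k : ℕ),
      ∫ x, e k x ∂μ = μ.real (E k) - p * μ.real Set.univ := fun μ _ k => by
    have h1 : Integrable ((E k).indicator (1 : Z → ℝ)) μ :=
      (integrable_const (1 : ℝ)).indicator (hE k)
    change ∫ x, ((E k).indicator 1 x - p) ∂μ = _
    rw [integral_sub h1 (integrable_const p), integral_indicator_one (hE k), integral_const,
      smul_eq_mul, mul_comm p]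
  have hee : ∀ j k, ∫ x, e j x * e k x ∂l = if j = k then p - p * p else 0 := fun j k => by
    have h : ∀ x, e j x * e k x = (E j ∩ E k).indicator 1 x - p * e j x - p * e k x - p * p := by
      intro x
      by_cases hj : x ∈ E j <;> by_cases hk : x ∈ E k <;> simp [e, hj, hk] <;> ring
    have hi : Integrable ((E j ∩ E k).indicator (1 : Z → ℝ)) l :=
      (integrable_const (1 : ℝ)).indicator ((hE j).inter (hE k))
    simp only [h]
    rw [integral_sub, integral_sub, integral_sub, integral_const_mul, integral_const_mul,
      integral_indicator_one ((hE j).inter (hE k)), hint, hint, hp, hp, probReal_univ,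
      integral_const, probReal_univ]
    · split_ifs with hjk
      · rw [hjk, Set.inter_self, hp, smul_eq_mul]; ring
      · rw [hpp j k hjk, smul_eq_mul]; ring
    · exact hi
    · exact (hei l j).const_mul p
    · exact hi.sub ((hei l j).const_mul p)
    · exact (hei l k).const_mul p
    · exact (hi.sub ((hei l j).const_mul p)).sub ((hei l k).const_mul p)
    · exact integrable_const _
  set d := q - p * ν.real Set.univ with hd
  have key : ∀ n : ℕ, (n * d) ^ 2 ≤ n := fun n => by
    let S : Z → ℝ := fun x => ∑ k ∈ Finset.range n, e k x
    have hSi : ∀ (μ : Measure Z) [IsFiniteMeasure μ], Integrable S μ := fun μ _ =>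
      integrable_finsetSum _ fun k _ => hei μ k
    have hSS : ∀ x, S x ^ 2 = ∑ j ∈ Finset.range n, ∑ k ∈ Finset.range n, e j x * e k x :=
      fun x => by rw [sq, Finset.sum_mul_sum]
    have hSSi : ∀ (μ : Measure Z) [IsFiniteMeasure μ], Integrable (fun x => S x ^ 2) μ :=
      fun μ _ => by
        simp only [hSS]
        exact integrable_finsetSum _ fun j _ => integrable_finsetSum _ fun k _ => heei μ j k
    have h1 : ∫ x, S x ∂ν = n * d := by
      rw [integral_finsetSum _ fun k _ => hei ν k]
      simp [hint, hq, hd]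
      ring
    have h2 : ∫ x, S x ^ 2 ∂l ≤ n := by
      simp only [hSS]
      rw [integral_finsetSum _ fun j _ => integrable_finsetSum _ fun k _ => heei l j k]
      have : ∀ j ∈ Finset.range n, ∫ x, ∑ k ∈ Finset.range n, e j x * e k x ∂l ≤ 1 := by
        intro j hj
        rw [integral_finsetSum _ fun k _ => heei l j k]
        simp only [hee, Finset.sum_ite_eq, hj, if_true]
        nlinarith
      simpa using Finset.sum_le_sum this
    have h3 : ∫ x, S x ^ 2 ∂ν ≤ ∫ x, S x ^ 2 ∂l :=
      integral_mono_measure hle (Eventually.of_forall fun x => sq_nonneg _) (hSSi l)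
    -- Cauchy–Schwarz: expand the integral of `(S - n * d) ^ 2`.
    have h4 : 0 ≤ ∫ x, (S x ^ 2 - 2 * (n * d) * S x + (n * d) ^ 2) ∂ν :=
      integral_nonneg fun x => by
        change (0 : ℝ) ≤ S x ^ 2 - 2 * (n * d) * S x + (n * d) ^ 2
        nlinarith [sq_nonneg (S x - n * d)]
    have h5 : Integrable (fun x => S x ^ 2 - 2 * (n * d) * S x) ν :=
      (hSSi ν).sub ((hSi ν).const_mul _)
    rw [integral_add h5 (integrable_const _), integral_sub (hSSi ν) ((hSi ν).const_mul _),
      integral_const_mul, h1, integral_const, smul_eq_mul] at h4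
    nlinarith [mul_le_mul_of_nonneg_right hν1 (sq_nonneg (n * d))]
  have hd0 : d = 0 := by
    by_contra hne
    have hpos : 0 < d ^ 2 := by positivity
    obtain ⟨n, hn⟩ := exists_nat_gt (1 / d ^ 2)
    have hn0 : (0 : ℝ) < n := lt_trans (by positivity) hn
    have h := key n
    rw [mul_pow, sq (n : ℝ), mul_assoc] at h
    have h' : (n : ℝ) * d ^ 2 ≤ 1 := by
      by_contra! hlt
      nlinarith
    rw [div_lt_iff₀ hpos] at hn
    linarith
  linarith

end Averaging

section Bernoulli

variable {Γ : Type*} [Group Γ] {ι : Type*} [MulAction Γ ι] {Y : Type*}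

attribute [local instance] arrowAction

theorem arrow_smul_apply (g : Γ) (x : ι → Y) (i : ι) : (g • x) i = x (g⁻¹ • i) := rfl

instance continuousConstSMul_arrow [TopologicalSpace Y] : ContinuousConstSMul Γ (ι → Y) :=
  ⟨fun _ => continuous_pi fun _ => continuous_apply _⟩

instance measurableConstSMul_arrow [MeasurableSpace Y] : MeasurableConstSMul Γ (ι → Y) :=
  ⟨fun _ => measurable_pi_lambda _ fun _ => measurable_pi_apply _⟩

theorem preimage_smul_pi [DecidableEq ι] (g : Γ) (s : Finset ι) (t : ι → Set Y) :
    (fun x : ι → Y => g • x) ⁻¹' (s : Set ι).pi t =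
      ((s.image (g⁻¹ • ·) : Finset ι) : Set ι).pi fun i => t (g • i) := by
  ext x
  simp [Set.mem_pi, arrow_smul_apply]

variable [MeasurableSpace Y] (r : Measure Y) [IsProbabilityMeasure r]

theorem infinitePi_preimage_smul_pi (g : Γ) (s : Finset ι) {t : ι → Set Y}
    (ht : ∀ i, MeasurableSet (t i)) :
    Measure.infinitePi (fun _ : ι => r) ((fun x : ι → Y => g • x) ⁻¹' (s : Set ι).pi t) =
      ∏ i ∈ s, r (t i) := by
  classical
  rw [preimage_smul_pi, Measure.infinitePi_pi _ fun i _ => ht _,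
    Finset.prod_image fun i _ j _ h => smul_left_cancel _ h]
  simp

instance smulInvariantMeasure_infinitePi :
    SMulInvariantMeasure Γ (ι → Y) (Measure.infinitePi fun _ : ι => r) := by
  refine ⟨fun g s hs => ?_⟩
  have h : (Measure.infinitePi fun _ : ι => r).map (fun x => g • x) =
      Measure.infinitePi fun _ : ι => r :=
    Measure.eq_infinitePi _ fun s t ht => by
      rw [Measure.map_apply (measurable_const_smul g)
        (MeasurableSet.pi s.countable_toSet fun i _ => ht i), infinitePi_preimage_smul_pi r g s ht]
  conv_rhs => rw [← h]
  rw [Measure.map_apply (measurable_const_smul g) hs]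

/-- A Bernoulli measure is extremal if the finite subsets of the index set have disjoint
translates: every box then has infinitely many pairwise independent translates, on which an
invariant measure takes the same value. -/
theorem isExtremalInvariant_infinitePi
    (hdisj : ∀ s t : Finset ι, ∃ g : Γ, ∀ i ∈ s, g • i ∉ t) :
    IsExtremalInvariant Γ (Measure.infinitePi fun _ : ι => r) := by
  classical
  intro ν hle hinv
  set l := Measure.infinitePi fun _ : ι => r with hl
  have hfin : IsFiniteMeasure ν := isFiniteMeasure_of_le l hle
  have hbox : ∀ (s : Finset ι) (t : ι → Set Y), (∀ i, MeasurableSet (t i)) →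
      ν.real ((s : Set ι).pi t) = (∏ i ∈ s, r.real (t i)) * ν.real Set.univ := by
    intro s t ht
    have hm : MeasurableSet ((s : Set ι).pi t) :=
      MeasurableSet.pi s.countable_toSet fun i _ => ht i
    -- Translates of the box by the elements `g k` depend on pairwise disjoint sets of coordinates.
    obtain ⟨g, -, hg⟩ := exists_seq_of_forall_finset_exists (fun _ : Γ => True)
      (fun g h => Disjoint (s.image (g⁻¹ • ·)) (s.image (h⁻¹ • ·))) fun S _ => by
        obtain ⟨h, hh⟩ := hdisj s (S.biUnion fun g => s.image (g⁻¹ • ·))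
        refine ⟨h⁻¹, trivial, fun g hg => ?_⟩
        rw [inv_inv, Finset.disjoint_right]
        intro i hi hi'
        obtain ⟨j, hj, rfl⟩ := Finset.mem_image.mp hi
        exact hh j hj (Finset.mem_biUnion.mpr ⟨g, hg, hi'⟩)
    have hg' : ∀ j k, j ≠ k →
        Disjoint (s.image ((g j)⁻¹ • ·)) (s.image ((g k)⁻¹ • ·)) := fun j k hjk => by
      rcases lt_or_gt_of_ne hjk with h | h
      · exact hg j k h
      · exact (hg k j h).symm
    refine measureReal_eq_of_pairwise_independent hle
      (E := fun k => (fun x : ι → Y => g k • x) ⁻¹' (s : Set ι).pi t)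
      (fun k => measurable_const_smul (g k) hm) (fun k => ?_) (fun j k hjk => ?_) (fun k => ?_)
    · rw [measureReal_def, hl, infinitePi_preimage_smul_pi r _ s ht, ENNReal.toReal_prod]
      rfl
    · let t' : ι → Set Y := fun i =>
        if i ∈ s.image ((g j)⁻¹ • ·) then t (g j • i) else t (g k • i)
      have hinter : (fun x : ι → Y => g j • x) ⁻¹' (s : Set ι).pi t ∩
          (fun x : ι → Y => g k • x) ⁻¹' (s : Set ι).pi t =
          ((s.image ((g j)⁻¹ • ·) ∪ s.image ((g k)⁻¹ • ·) : Finset ι) : Set ι).pi t' := by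
        rw [preimage_smul_pi, preimage_smul_pi, Finset.coe_union, Set.union_pi]
        refine congrArg₂ _ (Set.pi_congr rfl fun i hi => ?_) (Set.pi_congr rfl fun i hi => ?_)
        · exact (if_pos hi).symm
        · exact (if_neg (Finset.disjoint_right.mp (hg' j k hjk) hi)).symm
      have ht' : ∀ i, MeasurableSet (t' i) := fun i => by
        simp only [t']; split_ifs <;> exact ht _
      rw [measureReal_def, hinter, hl, Measure.infinitePi_pi _ fun i _ => ht' i,
        Finset.prod_union (hg' j k hjk), ENNReal.toReal_mul, ENNReal.toReal_prod,
        ENNReal.toReal_prod]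
      congr 1
      · rw [Finset.prod_image fun i _ j _ h => smul_left_cancel _ h]
        refine Finset.prod_congr rfl fun i hi => ?_
        simp only [t', if_pos (Finset.mem_image_of_mem _ hi), smul_inv_smul]
        rfl
      · rw [Finset.prod_image fun i _ j _ h => smul_left_cancel _ h]
        refine Finset.prod_congr rfl fun i hi => ?_
        simp only [t', if_neg (Finset.disjoint_right.mp (hg' j k hjk)
          (Finset.mem_image_of_mem _ hi)), smul_inv_smul]
        rfl
    · exact congrArg ENNReal.toReal (measure_preimage_smul ν (g k) _)
  have hbox' : ∀ (s : Finset ι) (t : ι → Set Y), (∀ i, MeasurableSet (t i)) →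
      ν ((s : Set ι).pi t) = (∏ i ∈ s, r (t i)) * ν Set.univ := fun s t ht => by
    rw [← ENNReal.toReal_eq_toReal_iff' (measure_ne_top _ _)
      (ENNReal.mul_ne_top (ENNReal.prod_ne_top fun i _ => measure_ne_top _ _)
        (measure_ne_top _ _)), ENNReal.toReal_mul, ENNReal.toReal_prod]
    exact hbox s t ht
  rcases eq_or_ne (ν Set.univ) 0 with h0 | h0
  · rw [h0, zero_smul]
    exact Measure.measure_univ_eq_zero.mp h0
  · have hscaled : (ν Set.univ)⁻¹ • ν = l := Measure.eq_infinitePi _ fun s t ht => by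
      rw [Measure.smul_apply, hbox' s t ht, smul_eq_mul, mul_comm, mul_assoc,
        ENNReal.mul_inv_cancel h0 (measure_ne_top _ _), mul_one]
    rw [← hscaled, smul_smul, ENNReal.mul_inv_cancel h0 (measure_ne_top _ _), one_smul]

theorem nullSingletonClass_infinitePi [Nonempty ι] [MeasurableSingletonClass Y]
    [NullSingletonClass r] : NullSingletonClass (Measure.infinitePi fun _ : ι => r) := by
  refine ⟨fun x => ?_⟩
  obtain ⟨i⟩ := ‹Nonempty ι›
  refine measure_mono_null (t := (fun y : ι → Y => y i) ⁻¹' {x i}) (fun y hy => by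
    rw [Set.mem_singleton_iff.mp hy]; rfl) ?_
  have h := (measurePreserving_eval_infinitePi (fun _ : ι => r) i).measure_preimage
    (measurableSet_singleton (x i)).nullMeasurableSet
  exact h.trans (measure_singleton _)

end Bernoulli

/-! ### Gaussian processes with prescribed covariance -/

section Gaussian

open ProbabilityTheory

/-- Every countable family of vectors lies in the algebraic span of an orthonormal family, by the
Gram–Schmidt process. -/
theorem exists_orthonormal_span {E : Type*} [NormedAddCommGroup E] [InnerProductSpace ℝ E]
    {κ : Type*} [Countable κ] (w : κ → E) :
    ∃ (b : Type) (e : b → E), Orthonormal ℝ e ∧ ∀ k, w k ∈ Submodule.span ℝ (Set.range e) := by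
  rcases isEmpty_or_nonempty κ with h | h
  · exact ⟨Empty, fun i => i.elim, ⟨fun i => i.elim, fun i => i.elim⟩, fun k => h.elim k⟩
  obtain ⟨s, hs⟩ := exists_surjective_nat κ
  let f := InnerProductSpace.gramSchmidtNormed ℝ (w ∘ s)
  refine ⟨{i | f i ≠ 0}, fun i => f i, InnerProductSpace.gramSchmidtNormed_orthonormal' _,
    fun k => ?_⟩
  obtain ⟨n, rfl⟩ := hs k
  have h1 : (w ∘ s) n ∈ Submodule.span ℝ (Set.range f) := by
    rw [InnerProductSpace.span_gramSchmidtNormed_range, InnerProductSpace.span_gramSchmidt]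
    exact Submodule.subset_span ⟨n, rfl⟩
  refine Submodule.span_le.mpr ?_ h1
  rintro _ ⟨i, rfl⟩
  by_cases hi : f i = 0
  · rw [hi]; exact zero_mem _
  · exact Submodule.subset_span ⟨⟨i, hi⟩, rfl⟩

/-- The law of a sequence of independent standard Gaussian variables. -/
noncomputable abbrev gaussianProduct (b : Type*) : Measure (b → ℝ) :=
  Measure.infinitePi fun _ : b => gaussianReal 0 1

theorem measurable_sum_mul_apply {κ : Type*} (a : κ →₀ ℝ) :
    Measurable fun x : κ → ℝ => a.sum fun k t => t * x k :=
  Finset.measurable_sum _ fun k _ => (measurable_pi_apply k).const_mul _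

/-- The characteristic function of a finite linear combination of independent standard Gaussian
variables. -/
theorem integral_exp_gaussianProduct {b : Type*} (d : b →₀ ℝ) :
    ∫ x, Complex.exp ((d.sum fun j a => a * x j : ℝ) * Complex.I) ∂gaussianProduct b =
      Complex.exp (-((d.sum fun _ a => a ^ 2 : ℝ) : ℂ) / 2) := by
  have h1 := integral_restrict_infinitePi (μ := fun _ : b => gaussianReal 0 1) (s := d.support)
    (f := fun y => ∏ j : d.support, Complex.exp (d j * y j * Complex.I))
    (Continuous.aestronglyMeasurable (by fun_prop))
  rw [integral_fintype_prod_eq_prod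
    (f := fun (j : d.support) (y : ℝ) => Complex.exp (d j * y * Complex.I))] at h1
  have h2 : ∀ x : b → ℝ, Complex.exp ((d.sum fun j a => a * x j : ℝ) * Complex.I) =
      ∏ j : d.support, Complex.exp (d j * d.support.restrict x j * Complex.I) := fun x => by
    rw [← Complex.exp_sum, Finsupp.sum, ← Finset.sum_coe_sort, Complex.ofReal_sum, Finset.sum_mul]
    simp
  simp only [h2]
  rw [h1]
  simp only [← charFun_apply_real, charFun_gaussianReal]
  rw [← Complex.exp_sum, Finsupp.sum]
  congr 1
  simp only [NNReal.coe_one, Complex.ofReal_zero, mul_zero, zero_mul, Complex.ofReal_one, one_mul,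
    zero_sub, Finset.sum_neg_distrib, Complex.ofReal_sum, Complex.ofReal_pow, neg_div,
    Finset.sum_div]
  exact congrArg Neg.neg (Finset.sum_coe_sort d.support fun j => (d j : ℂ) ^ 2 / 2)

/-- A finite measure on a product of real lines is determined by the characteristic functions of
the finite linear combinations of the coordinates. -/
theorem ext_of_integral_exp {κ : Type*} {P Q : Measure (κ → ℝ)} [IsFiniteMeasure P]
    [IsFiniteMeasure Q]
    (h : ∀ a : κ →₀ ℝ, ∫ x, Complex.exp ((a.sum fun k t => t * x k : ℝ) * Complex.I) ∂P =
      ∫ x, Complex.exp ((a.sum fun k t => t * x k : ℝ) * Complex.I) ∂Q) : P = Q := by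
  classical
  have hI : ∀ I : Finset κ, P.map I.restrict = Q.map I.restrict := fun I => by
    refine Measure.ext_of_charFunDual (funext fun L => ?_)
    let a : κ →₀ ℝ := Finsupp.onFinset I
      (fun k => if hk : k ∈ I then L (Pi.single ⟨k, hk⟩ 1) else 0)
      (fun k hk => by by_contra hk'; exact hk (dif_neg hk'))
    have hL : ∀ x : κ → ℝ, L (I.restrict x) = a.sum fun k t => t * x k := fun x => by
      have hsum : (a.sum fun k t => t * x k) = ∑ k ∈ I, a k * x k :=
        Finsupp.onFinset_sum _ fun k => zero_mul _
      rw [hsum, ← L.sum_comp_single, ← Finset.sum_coe_sort I]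
      refine Finset.sum_congr rfl fun k _ => ?_
      have hak : a k = L (Pi.single k 1) := dif_pos k.2
      have : Pi.single k (I.restrict x k) = x k • (Pi.single k 1 : I → ℝ) := by
        rw [← Pi.single_smul', smul_eq_mul, mul_one]; rfl
      change L (Pi.single k (I.restrict x k)) = a k * x k
      rw [this, map_smul, smul_eq_mul, mul_comm, hak]
    rw [charFunDual_apply, charFunDual_apply, integral_map (by fun_prop) (by fun_prop),
      integral_map (by fun_prop) (by fun_prop)]
    simp only [hL]
    exact h a
  exact IsProjectiveLimit.unique (P := fun I => Q.map I.restrict) hI fun I => rfl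

/-- The coordinates of a sequence of independent standard Gaussian variables, as elements
of `L²`. -/
noncomputable def gaussianCoord {b : Type*} (j : b) : Lp ℝ 2 (gaussianProduct b) :=
  MemLp.toLp (fun x : b → ℝ => x j)
    ((memLp_id_gaussianReal 2).comp_measurePreserving (measurePreserving_eval_infinitePi _ j))

theorem coeFn_gaussianCoord {b : Type*} (j : b) :
    (gaussianCoord j : (b → ℝ) → ℝ) =ᵐ[gaussianProduct b] fun x => x j :=
  MemLp.coeFn_toLp _

theorem orthonormal_gaussianCoord (b : Type*) :
    Orthonormal ℝ (gaussianCoord : b → Lp ℝ 2 (gaussianProduct b)) := by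
  classical
  rw [orthonormal_iff_ite]
  intro i j
  have h : inner ℝ (gaussianCoord i) (gaussianCoord j) = ∫ x, x j * x i ∂gaussianProduct b := by
    rw [L2.inner_def]
    refine integral_congr_ae ?_
    filter_upwards [coeFn_gaussianCoord i, coeFn_gaussianCoord j] with x hi hj
    refine (congrArg₂ (inner ℝ) hi hj).trans ?_
    rfl
  have hmap : ∀ (k : b) (f : ℝ → ℝ), Measurable f →
      ∫ x, f (x k) ∂gaussianProduct b = ∫ y, f y ∂gaussianReal 0 1 := fun k f hf => by
    rw [← (measurePreserving_eval_infinitePi (fun _ : b => gaussianReal 0 1) k).map_eq,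
      integral_map (measurable_pi_apply k).aemeasurable hf.aestronglyMeasurable]
  rw [h]
  split_ifs with hij
  · subst hij
    rw [hmap i (fun y => y * y) (by fun_prop)]
    have := variance_of_integral_eq_zero (X := id) (μ := gaussianReal 0 1) aemeasurable_id
      integral_id_gaussianReal
    rw [variance_id_gaussianReal] at this
    simpa [sq] using this.symm
  · have hind := (iIndepFun_infinitePi (P := fun _ : b => gaussianReal 0 1)
      (X := fun _ y => y) fun _ => measurable_id).indepFun (Ne.symm hij)
    have := hind.integral_mul_eq_mul_integral
      (measurable_pi_apply j).aestronglyMeasurable (measurable_pi_apply i).aestronglyMeasurable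
    refine this.trans ?_
    rw [hmap j (fun y => y) measurable_id, integral_id_gaussianReal, zero_mul]

/-- The centered Gaussian process with the covariance of a countable family of vectors. -/
theorem exists_gaussian {E : Type*} [NormedAddCommGroup E] [InnerProductSpace ℝ E]
    {κ : Type*} [Countable κ] (w : κ → E) :
    ∃ P : Measure (κ → ℝ), IsProbabilityMeasure P ∧
      (∀ a : κ →₀ ℝ, ∫ x, Complex.exp ((a.sum fun k t => t * x k : ℝ) * Complex.I) ∂P =
        Complex.exp (-((‖Finsupp.linearCombination ℝ w a‖ ^ 2 : ℝ) : ℂ) / 2)) ∧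
      (∀ k, MemLp (fun x : κ → ℝ => x k) 2 P) ∧
      ∀ k l, ∫ x, x k * x l ∂P = inner ℝ (w k) (w l) := by
  obtain ⟨b, e, he, hw⟩ := exists_orthonormal_span w
  have hc : ∀ k, ∃ c : b →₀ ℝ, Finsupp.linearCombination ℝ e c = w k := fun k =>
    (Finsupp.mem_span_range_iff_exists_finsupp).mp (hw k)
  choose c hc using hc
  let T : (b → ℝ) → κ → ℝ := fun x k => (c k).sum fun j a => a * x j
  have hT : Measurable T := measurable_pi_lambda _ fun k => measurable_sum_mul_apply (c k)
  have hTk : ∀ k, (fun x => T x k) =ᵐ[gaussianProduct b]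
      Finsupp.linearCombination ℝ gaussianCoord (c k) := fun k => by
    rw [Finsupp.linearCombination_apply, Finsupp.sum]
    refine EventuallyEq.trans ?_ (Lp.coeFn_finsetSum _ _).symm
    have h : ∀ j ∈ (c k).support, ∀ᵐ x ∂gaussianProduct b,
        (c k j • gaussianCoord j : Lp ℝ 2 (gaussianProduct b)) x = c k j * x j := fun j _ => by
      filter_upwards [Lp.coeFn_smul (c k j) (gaussianCoord j), coeFn_gaussianCoord j] with x h1 h2
      rw [h1, Pi.smul_apply, h2, smul_eq_mul]
    filter_upwards [(Finset.eventually_all _).mpr h] with x hx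
    rw [Finset.sum_apply]
    exact (Finset.sum_congr rfl hx).symm
  have hTm : ∀ k, MemLp (fun x => T x k) 2 (gaussianProduct b) := fun k =>
    (memLp_congr_ae (hTk k)).mpr (Lp.memLp _)
  refine ⟨(gaussianProduct b).map T, Measure.isProbabilityMeasure_map hT.aemeasurable,
    fun a => ?_, fun k => ?_, fun k l => ?_⟩
  · have hd : ∀ x, (a.sum fun k t => t * T x k) =
        (Finsupp.linearCombination ℝ c a).sum fun j t => t * x j := fun x => by
      exact (Finsupp.apply_linearCombination ℝ (Finsupp.linearCombination ℝ x) c a).symm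
    have hm : Measurable fun x : κ → ℝ =>
        Complex.exp ((a.sum fun k t => t * x k : ℝ) * Complex.I) :=
      Complex.measurable_exp.comp ((Complex.measurable_ofReal.comp
        (measurable_sum_mul_apply a)).mul_const _)
    rw [integral_map hT.aemeasurable hm.aestronglyMeasurable]
    simp only [hd]
    rw [integral_exp_gaussianProduct]
    have h1 : ‖Finsupp.linearCombination ℝ w a‖ ^ 2 =
        (Finsupp.linearCombination ℝ c a).sum fun _ t => t ^ 2 := by
      have h2 : Finsupp.linearCombination ℝ w a =
          Finsupp.linearCombination ℝ e (Finsupp.linearCombination ℝ c a) := by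
        rw [Finsupp.apply_linearCombination]
        exact congrArg (fun w => Finsupp.linearCombination ℝ w a) (funext fun k => (hc k).symm)
      rw [h2, ← real_inner_self_eq_norm_sq, he.inner_finsupp_eq_sum_left]
      exact Finsupp.sum_congr fun j _ => (sq _).symm
    rw [h1]
  · exact (memLp_map_measure_iff (measurable_pi_apply k).aestronglyMeasurable
      hT.aemeasurable).mpr (hTm k)
  · have hm : Measurable fun x : κ → ℝ => x k * x l :=
      (measurable_pi_apply k).mul (measurable_pi_apply l)
    rw [integral_map hT.aemeasurable hm.aestronglyMeasurable, ← hc k, ← hc l,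
      he.inner_finsupp_eq_sum_left, ← (orthonormal_gaussianCoord b).inner_finsupp_eq_sum_left,
      L2.inner_def]
    refine integral_congr_ae ?_
    filter_upwards [hTk k, hTk l] with x hk hl
    rw [hk, hl]
    exact mul_comm _ _

end Gaussian

/-! ### Gaussian actions -/

section GaussianAction

attribute [local instance] arrowAction

variable {Γ : Type u} [Group Γ] {ι : Type} [Countable ι] [MulAction Γ ι]
  {H : Type v} [NormedAddCommGroup H] [InnerProductSpace ℂ H] [CompleteSpace H]

/-- The complex number `a - i b` encoded by a pair `(a, b)` of extended real numbers, where infinite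
entries count as `0`. The sign makes the covariance of the Gaussian process below equal to twice the
inner product, and not to its conjugate. -/
noncomputable def ofERealPair (y : EReal × EReal) : ℂ := y.1.toReal - Complex.I * y.2.toReal

theorem measurable_ofERealPair : Measurable ofERealPair := by
  unfold ofERealPair
  fun_prop

/-- The real vectors `v i` and `I • v i`, which carry the real and the imaginary parts of the
complex Gaussian process attached to `v`. -/
noncomputable def realPair (v : ι → H) (k : ι × Bool) : H :=
  bif k.2 then Complex.I • v k.1 else v k.1

/-- An orbit of a unitary representation is, up to the factor `2`, the covariance of an invariant
complex Gaussian process. The values of the process are encoded as pairs of extended real numbers,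
which makes its state space compact. -/
theorem exists_invariant_gaussian (π : Γ →* unitary (H →L[ℂ] H)) {v : ι → H}
    (hv : ∀ (g : Γ) i, v (g • i) = (π g : H →L[ℂ] H) (v i)) :
    ∃ ν : Measure (ι → EReal × EReal), IsProbabilityMeasure ν ∧
      SMulInvariantMeasure Γ (ι → EReal × EReal) ν ∧
      (∀ i, MemLp (fun x : ι → EReal × EReal => ofERealPair (x i)) 2 ν) ∧
      ∀ i j, ∫ x, inner ℂ (ofERealPair (x i)) (ofERealPair (x j)) ∂ν =
        2 * inner ℂ (v i) (v j) := by
  let _ : InnerProductSpace ℝ H := InnerProductSpace.complexToReal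
  obtain ⟨P, hP, hexp, hL2, hcov⟩ := exists_gaussian (realPair v)
  let T : (ι × Bool → ℝ) → ι → EReal × EReal := fun x i => (x (i, false), x (i, true))
  have hT : Measurable T := by fun_prop
  have hofT : ∀ x i, ofERealPair (T x i) = x (i, false) - Complex.I * x (i, true) :=
    fun x i => rfl
  have hLT : ∀ i, MemLp (fun x => ofERealPair (T x i)) 2 P := fun i => by
    simp only [hofT]
    exact (hL2 (i, false)).ofReal.sub ((hL2 (i, true)).ofReal.const_mul _)
  have hm : ∀ i, Measurable fun x : ι → EReal × EReal => ofERealPair (x i) := fun i =>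
    measurable_ofERealPair.comp (measurable_pi_apply i)
  refine ⟨P.map T, Measure.isProbabilityMeasure_map hT.aemeasurable, ?_, fun i => ?_, fun i j => ?_⟩
  · have hσ : ∀ g : Γ, Measurable fun (x : ι × Bool → ℝ) (k : ι × Bool) => x (g⁻¹ • k.1, k.2) :=
      fun g => by fun_prop
    have hinv : ∀ g : Γ, P.map (fun x k => x (g⁻¹ • k.1, k.2)) = P := fun g => by
      have := Measure.isProbabilityMeasure_map (μ := P) (hσ g).aemeasurable
      refine ext_of_integral_exp fun a => ?_
      have hme : Measurable fun x : ι × Bool → ℝ =>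
          Complex.exp ((a.sum fun k t => t * x k : ℝ) * Complex.I) :=
        Complex.measurable_exp.comp ((Complex.measurable_ofReal.comp
          (measurable_sum_mul_apply a)).mul_const _)
      rw [integral_map (hσ g).aemeasurable hme.aestronglyMeasurable, hexp]
      let τ : ι × Bool → ι × Bool := fun k => (g⁻¹ • k.1, k.2)
      have h1 : ∀ x : ι × Bool → ℝ, (a.sum fun k t => t * x (g⁻¹ • k.1, k.2)) =
          (a.mapDomain τ).sum fun k t => t * x k := fun x => by
        rw [Finsupp.sum_mapDomain_index (fun _ => zero_mul _) fun _ _ _ => add_mul _ _ _]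
      simp only [h1]
      rw [hexp, Finsupp.linearCombination_mapDomain]
      have h2 : realPair v ∘ τ =
          fun k => ((π g⁻¹ : H →L[ℂ] H).restrictScalars ℝ) (realPair v k) := by
        funext ⟨i, b⟩
        cases b <;> simp [realPair, τ, hv]
      have h3 := Finsupp.apply_linearCombination ℝ
        ((π g⁻¹ : H →L[ℂ] H).restrictScalars ℝ).toLinearMap (realPair v) a
      rw [h2]
      refine (congrArg (fun t : H => Complex.exp (-((‖t‖ ^ 2 : ℝ) : ℂ) / 2)) h3.symm).trans ?_
      congr 5
      exact Unitary.norm_map _ _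
    refine ⟨fun g s hs => ?_⟩
    rw [Measure.map_apply hT (measurable_const_smul g hs), Measure.map_apply hT hs]
    conv_rhs => rw [← hinv g]
    rw [Measure.map_apply (hσ g) (hT hs)]
    rfl
  · exact (memLp_map_measure_iff (hm i).aestronglyMeasurable hT.aemeasurable).mpr (hLT i)
  · have hmi : Measurable fun x : ι → EReal × EReal =>
        inner ℂ (ofERealPair (x i)) (ofERealPair (x j)) := (hm i).inner (hm j)
    rw [integral_map hT.aemeasurable hmi.aestronglyMeasurable]
    simp only [hofT]
    have hint : ∀ k l, Integrable (fun x : ι × Bool → ℝ => x k * x l) P := fun k l =>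
      (hL2 k).integrable_mul (hL2 l)
    have h1 : ∀ x : ι × Bool → ℝ, inner ℂ ((x (i, false) : ℂ) - Complex.I * x (i, true))
        ((x (j, false) : ℂ) - Complex.I * x (j, true)) =
        ((x (i, false) * x (j, false) + x (i, true) * x (j, true) : ℝ) : ℂ) +
        ((x (i, true) * x (j, false) - x (i, false) * x (j, true) : ℝ) : ℂ) * Complex.I := by
      intro x
      simp only [RCLike.inner_apply, map_sub, map_mul, Complex.conj_I, Complex.conj_ofReal]
      push_cast
      linear_combination (-(x (i, true) * x (j, true)) : ℂ) * Complex.I_sq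
    simp only [h1]
    rw [integral_add (((hint _ _).add (hint _ _)).ofReal)
      ((((hint _ _).sub (hint _ _)).ofReal).mul_const _), integral_mul_const,
      integral_complex_ofReal, integral_complex_ofReal, integral_add (hint _ _) (hint _ _),
      integral_sub (hint _ _) (hint _ _), hcov, hcov, hcov, hcov]
    simp only [realPair, cond_true, cond_false, real_inner_eq_re_inner ℂ, inner_smul_left,
      inner_smul_right]
    apply Complex.ext <;> simp <;> ring

end GaussianAction

section Bound

attribute [local instance] arrowAction

variable {G : Type u} [Group G]
  {H : Type v} [NormedAddCommGroup H] [InnerProductSpace ℂ H] [CompleteSpace H]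

instance smulInvariantMeasure_prod {Γ A B : Type*} [Group Γ] [MulAction Γ A] [MulAction Γ B]
    [MeasurableSpace A] [MeasurableSpace B] [MeasurableConstSMul Γ A] [MeasurableConstSMul Γ B]
    (μ : Measure A) (ν : Measure B) [SFinite μ] [SFinite ν] [SMulInvariantMeasure Γ A μ]
    [SMulInvariantMeasure Γ B ν] : SMulInvariantMeasure Γ (A × B) (μ.prod ν) :=
  ⟨fun g _ hs => ((measurePreserving_smul g μ).prod (measurePreserving_smul g ν)).measure_preimage
    hs.nullMeasurableSet⟩

/-- If the orbits of two vectors under two unitary representations have proportional Gram matrices,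
then a norm bound for the first representation applies to the second vector. -/
theorem norm_groupRingRep_apply_le_of_gram {Γ : Type*} [Group Γ] {K : Type*}
    [NormedAddCommGroup K] [InnerProductSpace ℂ K] [CompleteSpace K]
    (κ : Γ →* unitary (K →L[ℂ] K)) (π : Γ →* unitary (H →L[ℂ] H)) {f : K} {ξ : H} {c : ℝ}
    (hc : 0 < c) (h : ∀ g g' : Γ, inner ℂ ((κ g : K →L[ℂ] K) f) ((κ g' : K →L[ℂ] K) f) =
      (c : ℂ) ^ 2 * inner ℂ ((π g : H →L[ℂ] H) ξ) ((π g' : H →L[ℂ] H) ξ))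
    {φ : MonoidAlgebra ℂ Γ} {C : ℝ} (hC : ‖groupRingRep κ φ‖ ≤ C) :
    ‖groupRingRep π φ ξ‖ ≤ C * ‖ξ‖ := by
  have hgram := norm_linearCombination_eq_of_gram hc.le h
  have hφ : ‖groupRingRep κ φ f‖ = c * ‖groupRingRep π φ ξ‖ := by
    rw [groupRingRep_apply, groupRingRep_apply]
    exact hgram _
  have hξ : ‖f‖ = c * ‖ξ‖ := by
    simpa using hgram (Finsupp.single 1 1)
  have hle := (groupRingRep κ φ).le_of_opNorm_le hC f
  rw [hφ, hξ, mul_left_comm] at hle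
  exact le_of_mul_le_mul_left hle hc

/-- The group acts on the product of a Gaussian system that contains the representation `π` and of
a Bernoulli shift, which serves as a diffuse extremal factor. -/
theorem norm_groupRingRep_apply_le_of_orbit (hG : RichlySynergodic G)
    (π : G × G →* unitary (H →L[ℂ] H)) {ι : Type} [Countable ι] [MulAction (G × G) ι] {v : ι → H}
    (hv : ∀ (g : G × G) i, v (g • i) = (π g : H →L[ℂ] H) (v i))
    (hdisj : ∀ s t : Finset ι, ∃ g : G × G, ∀ i ∈ s, g • i ∉ t) (i₀ : ι)
    (φ : MonoidAlgebra ℂ (G × G)) :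
    ‖groupRingRep π φ (v i₀)‖ ≤ minTensorNorm (toTensor G φ) * ‖v i₀‖ := by
  obtain ⟨ν, hν, hνi, hL2, hcov⟩ := exists_invariant_gaussian π hv
  let l : Measure (ι → unitInterval) := Measure.infinitePi fun _ => volume
  have hna : NullSingletonClass l :=
    have : Nonempty ι := ⟨i₀⟩
    nullSingletonClass_infinitePi _
  let μ : Measure ((ι → EReal × EReal) × (ι → unitInterval)) := ν.prod l
  have hμ : SMulInvariantMeasure (G × G) _ μ := smulInvariantMeasure_prod ν l
  have hl : IsExtremalInvariant (G × G) l := isExtremalInvariant_infinitePi _ hdisj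
  have hsnd : μ.map Prod.snd = l := by
    rw [Measure.map_snd_prod, measure_univ, one_smul]
  let κ := koopman.comp (actOfSMul (G × G) μ)
  have hbound : ‖groupRingRep κ φ‖ ≤ minTensorNorm (toTensor G φ) :=
    norm_koopman_le_of_factor hG (p := ⟨Prod.snd, continuous_snd⟩) (fun g x => rfl)
      hl hsnd φ
  have hFm : ∀ i, MemLp (fun x : (ι → EReal × EReal) × (ι → unitInterval) =>
      ofERealPair (x.1 i)) 2 μ := fun i =>
    (hL2 i).comp_measurePreserving measurePreserving_fst
  let F : ι → Lp ℂ 2 μ := fun i => (hFm i).toLp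
  have hF : ∀ i, F i =ᵐ[μ] fun x => ofERealPair (x.1 i) := fun i => (hFm i).coeFn_toLp
  have hκ : ∀ g : G × G, (κ g : Lp ℂ 2 μ →L[ℂ] Lp ℂ 2 μ) (F i₀) = F (g • i₀) := fun g => by
    refine Lp.ext ?_
    refine (coeFn_koopman_mk _ (measurePreserving_smul g μ) _).trans ?_
    refine ((measurePreserving_smul g⁻¹ μ).quasiMeasurePreserving.ae_eq_comp (hF i₀)).trans ?_
    refine EventuallyEq.trans (Eventually.of_forall fun x => ?_) (hF (g • i₀)).symm
    change ofERealPair (x.1 ((g⁻¹)⁻¹ • i₀)) = _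
    rw [inv_inv]
  have hin : ∀ i j, inner ℂ (F i) (F j) = 2 * inner ℂ (v i) (v j) := fun i j => by
    have hm : Measurable fun x : ι → EReal × EReal =>
        inner ℂ (ofERealPair (x i)) (ofERealPair (x j)) :=
      (measurable_ofERealPair.comp (measurable_pi_apply i)).inner
        (measurable_ofERealPair.comp (measurable_pi_apply j))
    rw [← hcov, ← (measurePreserving_fst (μ := ν) (ν := l)).map_eq, L2.inner_def,
      integral_map measurable_fst.aemeasurable hm.aestronglyMeasurable]
    refine integral_congr_ae ?_
    filter_upwards [hF i, hF j] with x hi hj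
    rw [hi, hj]
  refine norm_groupRingRep_apply_le_of_gram κ π (f := F i₀) (Real.sqrt_pos.mpr two_pos)
    (fun g h => ?_) hbound
  rw [hκ, hκ, hin, ← Complex.ofReal_pow, Real.sq_sqrt zero_le_two, Complex.ofReal_ofNat, hv, hv]

/-- The bound for the Koopman representations extends to all unitary representations of `G × G`. -/
theorem norm_groupRingRep_le_minTensorNorm [Countable G] [Infinite G] (hG : RichlySynergodic G)
    (π : G × G →* unitary (H →L[ℂ] H)) (φ : MonoidAlgebra ℂ (G × G)) :
    ‖groupRingRep π φ‖ ≤ minTensorNorm (toTensor G φ) := by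
  have h0 : 0 ≤ minTensorNorm (toTensor G φ) :=
    (norm_nonneg _).trans (norm_sum_opTensor_le_minTensorNorm
      (H := EuclideanSpace ℂ PEmpty.{u + 1}) (K := EuclideanSpace ℂ PEmpty.{u + 1}) 1 1 φ)
  refine ContinuousLinearMap.opNorm_le_bound _ h0 fun ξ => ?_
  let e : G × G ≃ Shrink.{0} (G × G) := equivShrink.{0} (G × G)
  have : Countable (Shrink.{0} (G × G)) := e.symm.countable_iff.mpr inferInstance
  have he : ∀ (g : G × G) i, e.symm (g • i) = g * e.symm i := fun g i =>
    equivShrink_symm_smul g i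
  have hdisj : ∀ s t : Finset (Shrink.{0} (G × G)), ∃ g : G × G, ∀ i ∈ s, g • i ∉ t :=
    fun s t => by
      classical
      obtain ⟨g, hg⟩ := Infinite.exists_notMem_finset
        ((t ×ˢ s).image fun p => e.symm p.1 * (e.symm p.2)⁻¹)
      refine ⟨g, fun i hi hgi => hg (Finset.mem_image.mpr ⟨(g • i, i), ?_, ?_⟩)⟩
      · exact Finset.mem_product.mpr ⟨hgi, hi⟩
      · simp [he]
  have h := norm_groupRingRep_apply_le_of_orbit hG π
    (v := fun i => (π (e.symm i) : H →L[ℂ] H) ξ) (fun g i => by rw [he, map_mul]; rfl) hdisj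
    (e 1) φ
  simpa using h

end Bound

theorem corollary4p9 (G : Type u) [Group G] [Countable G] [Infinite G]
    (hG : RichlySynergodic G) (φ : MonoidAlgebra ℂ (G × G)) :
    maxTensorNorm (toTensor G φ) = minTensorNorm (toTensor G φ) :=
  le_antisymm (maxTensorNorm_le_of_forall_rep fun _ _ _ _ ρ =>
    norm_groupRingRep_le_minTensorNorm hG ρ φ) (minTensorNorm_le_maxTensorNorm _)
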